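/- Let $\omega>0$ and let $A:\mathbb{R}\to\mathcal{L}(\mathbb{R}^n)$ (real $n\times n$ matrices with the operator norm) have bounded variation on every compact interval. Write $\Delta^-A(t)=A(t)-A(t^-)$ and $\Delta^+A(t)=A(t^+)-A(t)$. Assume that $I-\Delta^-A(t)$ and $I+\Delta^+A(t)$ are invertible for every $t\in\mathbb{R}$, and that there is a constant matrix $C$ with $A(t+\omega)-A(t)=C$ for all $t\in\mathbb{R}$. Then the homogeneous generalized linear differential equation $$\frac{dx}{d\tau}=D[A(t)x]$$ has a unique transition matrix, that is, there is exactly one function $U:\mathbb{R}\times\mathbb{R}\to\mathcal{L}(\mathbb{R}^n)$ such that $$U(t,s)=I+\int_s^t \mathrm{d}[A(r)]\,U(r,s)\qquad\text{for all } t,s\in\mathbb{R},$$ where the integral is the Kurzweil--Stieltjes integral (required to exist, column by column): for $a\le b$, $\int_a^b \mathrm{d}[A(s)]f(s)=X$ means that for every $\varepsilon>0$ there is a function $\delta:[a,b]\to(0,\infty)$ such that $\bigl\|\sum_{j}[A(\alpha_j)-A(\alpha_{j-1})]f(\tau_j)-X\bigr\|<\varepsilon$ for every partition $a=\alpha_0<\dots<\alpha_m=b$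 with tags $\tau_j\in[\alpha_{j-1},\alpha_j]\subset(\tau_j-\delta(\tau_j),\tau_j+\delta(\tau_j))$; and $\int_b^a=-\int_a^b$. Put $\mathcal{U}(t)=U(t,0)$. The equation admits an exponential dichotomy on $\mathbb{R}$, that is, there exist constants $K>0$, $\alpha>0$ and a matrix $P\in\mathcal{L}(\mathbb{R}^n)$ with $P^2=P$ such that $$\|\mathcal{U}(t)P\,\mathcal{U}^{-1}(s)\|\le Ke^{-\alpha(t-s)}\ \text{ for all } t\ge s,\qquad \|\mathcal{U}(t)(I-P)\,\mathcal{U}^{-1}(s)\|\le Ke^{-\alpha(s-t)}\ \text{ for all } s\ge t,$$ if and only if no complex eigenvalue $\lambda$ of the monodromy matrix $U(\omega,0)$ satisfies $|\lambda|=1$. -/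

import Mathlib

/-- Real Euclidean `n`-space. -/
abbrev RSpace (n : ℕ) : Type := EuclideanSpace ℝ (Fin n)

/-- Linear operators on `ℝⁿ` (real `n × n` matrices), with the operator norm. -/
abbrev ROp (n : ℕ) : Type := RSpace n →L[ℝ] RSpace n

/-- The data `α 0 < α 1 < ⋯ < α m` with tags `τ j ∈ [α j, α (j+1)]`, `j < m`, form a tagged
partition of `[a, b]` which is fine with respect to the gauge `δ`. -/
def IsFineTaggedPartition (δ : ℝ → ℝ) (a b : ℝ) (m : ℕ) (α τ : ℕ → ℝ) : Prop :=
  α 0 = a ∧ α m = b ∧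
    ∀ j < m, α j < α (j + 1) ∧ τ j ∈ Set.Icc (α j) (α (j + 1)) ∧
      Set.Icc (α j) (α (j + 1)) ⊆ Set.Ioo (τ j - δ (τ j)) (τ j + δ (τ j))

/-- For `a ≤ b`: `f` is Kurzweil–Stieltjes integrable with respect to `A` on `[a, b]`, and
`∫ₐᵇ d[A(s)] f(s) = X`. -/
def HasKSIntegralIcc {n : ℕ} (A : ℝ → ROp n) (f : ℝ → RSpace n) (a b : ℝ) (X : RSpace n) : Prop :=
  ∀ ε > 0, ∃ δ : ℝ → ℝ, (∀ t ∈ Set.Icc a b, 0 < δ t) ∧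
    ∀ (m : ℕ) (α τ : ℕ → ℝ), IsFineTaggedPartition δ a b m α τ →
      ‖∑ j ∈ Finset.range m, (A (α (j + 1)) - A (α j)) (f (τ j)) - X‖ < ε

/-- The oriented Kurzweil–Stieltjes integral `∫ₐᵇ d[A(s)] f(s)` exists and equals `X`, with
`∫ₐᵇ = -∫_bᵃ` when `b < a`. -/
def HasKSIntegral {n : ℕ} (A : ℝ → ROp n) (f : ℝ → RSpace n) (a b : ℝ) (X : RSpace n) : Prop :=
  if a ≤ b then HasKSIntegralIcc A f a b X else HasKSIntegralIcc A f b a (-X)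

/-- The jump `Δ⁺Φ(t) = Φ(t⁺) - Φ(t)`. -/
noncomputable def jumpRight {n : ℕ} (Φ : ℝ → ROp n) (t : ℝ) : ROp n :=
  Function.rightLim Φ t - Φ t

/-- The jump `Δ⁻Φ(t) = Φ(t) - Φ(t⁻)`. -/
noncomputable def jumpLeft {n : ℕ} (Φ : ℝ → ROp n) (t : ℝ) : ROp n :=
  Φ t - Function.leftLim Φ t

/-- Condition (H): `I - Δ⁻A(t)` and `I + Δ⁺A(t)` are invertible for every `t`. -/
def ConditionH {n : ℕ} (A : ℝ → ROp n) : Prop :=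
  ∀ t : ℝ, IsUnit (1 - jumpLeft A t) ∧ IsUnit (1 + jumpRight A t)

/-- `U` is a transition matrix of `dx/dτ = D[A(t)x]`:
`U(t,s) = I + ∫ₛᵗ d[A(r)] U(r,s)` for all `t, s`, the integral being taken vector by vector. -/
def IsTransitionMatrix {n : ℕ} (A : ℝ → ROp n) (U : ℝ → ℝ → ROp n) : Prop :=
  ∀ (t s : ℝ) (v : RSpace n), HasKSIntegral A (fun r => U r s v) s t (U t s v - v)

/-- Exponential dichotomy on `ℝ` of the equation with transition matrix `U`, where
`𝒰(t) = U(t,0)`. -/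
def HasExponentialDichotomy {n : ℕ} (U : ℝ → ℝ → ROp n) : Prop :=
  ∃ (K α : ℝ) (P : ROp n), 0 < K ∧ 0 < α ∧ P * P = P ∧
    (∀ t s : ℝ, s ≤ t →
      ‖U t 0 * P * Ring.inverse (U s 0)‖ ≤ K * Real.exp (-α * (t - s))) ∧
    (∀ t s : ℝ, t ≤ s →
      ‖U t 0 * (1 - P) * Ring.inverse (U s 0)‖ ≤ K * Real.exp (-α * (s - t)))

/-- The matrix of `M` in the standard basis, viewed as a complex matrix. -/
noncomputable def complexMatrix {n : ℕ} (M : ROp n) : Matrix (Fin n) (Fin n) ℂ :=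
  (LinearMap.toMatrix (EuclideanSpace.basisFun (Fin n) ℝ).toBasis
    (EuclideanSpace.basisFun (Fin n) ℝ).toBasis (M : RSpace n →ₗ[ℝ] RSpace n)).map
    (algebraMap ℝ ℂ)

/-- `μ ∈ ℂ` is an eigenvalue of the real matrix `M`. -/
def IsComplexEigenvalue {n : ℕ} (M : ROp n) (μ : ℂ) : Prop :=
  Module.End.HasEigenvalue (Matrix.toLin' (complexMatrix M)) μ

open Set Filter Topology Asymptotics

/-!
Let `V` be a monotone function controlling the increments of `A`. The integral equation is
equivalent to the first-order condition `X t / X τ = 1 + (A t - A τ) + o(V t - V τ)` at every `τ`.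
Near `τ` the functions `(1 + (A t - A(τ⁺))) (1 + (A(τ⁺) - A τ))`, and their mirror images, satisfy
it up to an arbitrarily small multiple of `V t - V τ`. Gluing them by Cousin's lemma gives
approximate solutions whose transition operators are bounded independently of the precision, and
these converge to a solution. It is unique, because `(X t)⁻¹ y(t)` has zero derivative with respect
to `V` for every other solution `y`.

Uniqueness and the constancy of `A (t + ω) - A t` give Floquet's relation `X (t + ω) = X t * X ω`.
Hence a dichotomy amounts to a splitting of `ℝⁿ` into the vectors contracted by the forward and by
the backward iterates of the monodromy operator. If no eigenvalue has modulus `1`, the generalized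
eigenspaces over `ℂ` provide it. An eigenvalue of modulus `1` gives a nonzero bounded orbit, which a
dichotomy excludes.
-/

theorem cousin_induction {P : ℝ → ℝ → Prop} {a b : ℝ} (hab : a ≤ b)
    (refl : ∀ τ ∈ Icc a b, P τ τ)
    (trans : ∀ x y z, a ≤ x → x ≤ y → y ≤ z → z ≤ b → P x y → P y z → P x z)
    (right : ∀ τ ∈ Ico a b, ∀ᶠ t in 𝓝[>] τ, P τ t)
    (left : ∀ τ ∈ Ioc a b, ∀ᶠ t in 𝓝[<] τ, P t τ) : P a b := by
  set S : Set ℝ := {x | ∀ s ∈ Icc a x, P a s}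
  have ha : P a a := refl a ⟨le_rfl, hab⟩
  have closed : IsClosed (S ∩ Icc a b) := by
    refine isClosed_of_closure_subset fun x hx => ?_
    have hxI : x ∈ Icc a b := isClosed_Icc.closure_subset_iff.2 inter_subset_right hx
    have below : ∀ s ∈ Ico a x, P a s := fun s hs => by
      obtain ⟨t, hst, ht⟩ := mem_closure_iff.1 hx (Ioi s) isOpen_Ioi hs.2
      exact ht.1 s ⟨hs.1, le_of_lt hst⟩
    refine ⟨fun s hs => ?_, hxI⟩
    rcases hs.2.lt_or_eq with hsx | rfl
    · exact below s ⟨hs.1, hsx⟩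
    · rcases hs.1.eq_or_lt with rfl | has
      · exact ha
      · obtain ⟨t, hts, ht⟩ := ((left s ⟨has, hxI.2⟩).and (Ioo_mem_nhdsLT has)).exists
        exact trans a t s le_rfl ht.1.le ht.2.le hxI.2 (below t ⟨ht.1.le, ht.2⟩) hts
  have hS : Icc a b ⊆ S := by
    refine closed.Icc_subset_of_forall_exists_gt ?_ fun x hx y hxy => ?_
    · rintro s ⟨has, hsa⟩
      obtain rfl : s = a := le_antisymm hsa has
      exact ha
    · obtain ⟨u, hu, hP⟩ := mem_nhdsGT_iff_exists_Ioc_subset.1 (right x hx.2)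
      refine ⟨min u (min y b), fun s hs => ?_, lt_min hu (lt_min hxy hx.2.2),
        (min_le_right _ _).trans (min_le_left _ _)⟩
      rcases le_or_gt s x with hsx | hxs
      · exact hx.1 s ⟨hs.1, hsx⟩
      · exact trans a x s le_rfl hx.2.1 hxs.le
          (hs.2.trans ((min_le_right _ _).trans (min_le_right _ _)))
          (hx.1 x ⟨hx.2.1, le_rfl⟩) (hP ⟨hxs, hs.2.trans (min_le_left _ _)⟩)
  exact hS ⟨hab, le_rfl⟩ b ⟨hab, le_rfl⟩

theorem nhdsGT_le_nhdsWithin_Icc {a b τ : ℝ} (hτ : τ ∈ Ico a b) : 𝓝[>] τ ≤ 𝓝[Icc a b] τ :=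
  nhdsWithin_le_of_mem (Icc_mem_nhdsGT_of_mem hτ)

theorem nhdsLT_le_nhdsWithin_Icc {a b τ : ℝ} (hτ : τ ∈ Ioc a b) : 𝓝[<] τ ≤ 𝓝[Icc a b] τ :=
  nhdsWithin_le_of_mem (Icc_mem_nhdsLT_of_mem hτ)

theorem norm_sub_le_of_isBigOWith {E : Type*} [SeminormedAddCommGroup E] {f : ℝ → E} {V : ℝ → ℝ}
    (hV : Monotone V) {K a b : ℝ}
    (hloc : ∀ τ ∈ Icc a b,
      IsBigOWith K (𝓝[Icc a b] τ) (fun t => f t - f τ) fun t => V t - V τ)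
    {s t : ℝ} (hs : s ∈ Icc a b) (ht : t ∈ Icc a b) : ‖f t - f s‖ ≤ K * |V t - V s| := by
  wlog hst : s ≤ t generalizing s t
  · rw [norm_sub_rev, abs_sub_comm]
    exact this ht hs (le_of_not_ge hst)
  rw [abs_of_nonneg (sub_nonneg.2 (hV hst))]
  refine cousin_induction (P := fun x y => ‖f y - f x‖ ≤ K * (V y - V x)) hst (by simp) ?_ ?_ ?_
  · intro x y z _ _ _ _ hxy hyz
    calc ‖f z - f x‖ ≤ ‖f z - f y‖ + ‖f y - f x‖ := norm_sub_le_norm_sub_add_norm_sub _ _ _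
      _ ≤ K * (V z - V x) := by linarith
  · intro τ hτ
    have hτ' : τ ∈ Ico a b := ⟨hs.1.trans hτ.1, hτ.2.trans_le ht.2⟩
    filter_upwards [nhdsGT_le_nhdsWithin_Icc hτ' (hloc τ (Ico_subset_Icc_self hτ')).bound,
      self_mem_nhdsWithin] with u hu hτu
    rwa [Real.norm_of_nonneg (sub_nonneg.2 (hV (le_of_lt hτu)))] at hu
  · intro τ hτ
    have hτ' : τ ∈ Ioc a b := ⟨hs.1.trans_lt hτ.1, hτ.2.trans ht.2⟩
    filter_upwards [nhdsLT_le_nhdsWithin_Icc hτ' (hloc τ (Ioc_subset_Icc_self hτ')).bound,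
      self_mem_nhdsWithin] with u hu hτu
    rwa [norm_sub_rev, norm_sub_rev (V u), Real.norm_of_nonneg (sub_nonneg.2 (hV (le_of_lt hτu)))]
      at hu

theorem eq_of_isLittleO {E : Type*} [NormedAddCommGroup E] {f : ℝ → E} {V : ℝ → ℝ}
    (hV : Monotone V) {a b : ℝ}
    (hloc : ∀ τ ∈ Icc a b, (fun t => f t - f τ) =o[𝓝[Icc a b] τ] fun t => V t - V τ)
    {s t : ℝ} (hs : s ∈ Icc a b) (ht : t ∈ Icc a b) : f t = f s := by
  have small : ∀ᶠ c : ℝ in 𝓝[>] 0, ‖f t - f s‖ ≤ c * |V t - V s| := by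
    filter_upwards [self_mem_nhdsWithin] with c hc using
      norm_sub_le_of_isBigOWith hV (fun τ hτ => (hloc τ hτ).forall_isBigOWith hc) hs ht
  have cont : Continuous fun c : ℝ => c * |V t - V s| := by fun_prop
  have lim := (cont.tendsto' 0 0 (zero_mul _)).mono_left (nhdsWithin_le_nhds (s := Ioi 0))
  exact sub_eq_zero.1 (norm_le_zero_iff.1 (ge_of_tendsto lim small))

section FundamentalSolution

variable {R : Type*} [NormedRing R]

/-- `A` has increments controlled by the monotone function `V`, and one-sided jumps which become
invertible when added to the identity. The left jump is written `L - A τ` with `L = A(τ⁻)`, so that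
both sides have the same form. -/
structure IsRegularIntegrator (A : ℝ → R) (V : ℝ → ℝ) : Prop where
  mono : Monotone V
  norm_sub_le : ∀ s t, ‖A t - A s‖ ≤ |V t - V s|
  right : ∀ τ, ∃ L, Tendsto A (𝓝[>] τ) (𝓝 L) ∧ IsUnit (1 + (L - A τ))
  left : ∀ τ, ∃ L, Tendsto A (𝓝[<] τ) (𝓝 L) ∧ IsUnit (1 + (L - A τ))

/-- `X` is a fundamental solution of `dX = d[A] X` on `S` up to a relative error `ε`, measured
against the control function `V`. -/
def IsApproxFundamentalSolOn (A : ℝ → R) (V : ℝ → ℝ) (ε : ℝ) (S : Set ℝ) (X : ℝ → Rˣ) : Prop :=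
  ∀ τ ∈ S, IsBigOWith ε (𝓝[S] τ)
    (fun t => ((X t / X τ : Rˣ) : R) - (1 + (A t - A τ))) fun t => V t - V τ

/-- `X` is a fundamental solution of `dX = d[A] X` on `S`: its transition operators agree with
`1 + ΔA` to first order with respect to the control function `V`. -/
def IsFundamentalSolOn (A : ℝ → R) (V : ℝ → ℝ) (S : Set ℝ) (X : ℝ → Rˣ) : Prop :=
  ∀ τ ∈ S, (fun t => ((X t / X τ : Rˣ) : R) - (1 + (A t - A τ))) =o[𝓝[S] τ] fun t => V t - V τ

/-- The transition operators `X t / X s` between points of `S` are bounded by `C`. -/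
def IsTransitionBoundOn (C : ℝ) (S : Set ℝ) (X : ℝ → Rˣ) : Prop :=
  ∀ s ∈ S, ∀ t ∈ S, ‖((X t / X s : Rˣ) : R)‖ ≤ C

variable {A : ℝ → R} {V : ℝ → ℝ}

theorem isFundamentalSolOn_iff {S : Set ℝ} {X : ℝ → Rˣ} :
    IsFundamentalSolOn A V S X ↔ ∀ ε > 0, IsApproxFundamentalSolOn A V ε S X := by
  simp only [IsFundamentalSolOn, IsApproxFundamentalSolOn, isLittleO_iff_forall_isBigOWith]
  exact ⟨fun h ε hε τ hτ => h τ hτ hε, fun h τ hτ ε hε => h ε hε τ hτ⟩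

theorem IsApproxFundamentalSolOn.mono {ε : ℝ} {S T : Set ℝ} {X : ℝ → Rˣ}
    (h : IsApproxFundamentalSolOn A V ε T X) (hST : S ⊆ T) :
    IsApproxFundamentalSolOn A V ε S X :=
  fun τ hτ => (h τ (hST hτ)).mono (nhdsWithin_mono τ hST)

theorem IsApproxFundamentalSolOn.weaken {ε ε' : ℝ} {S : Set ℝ} {X : ℝ → Rˣ}
    (h : IsApproxFundamentalSolOn A V ε S X) (hε : ε ≤ ε') :
    IsApproxFundamentalSolOn A V ε' S X :=
  fun τ hτ => (h τ hτ).weaken hε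

theorem isApproxFundamentalSolOn_Icc_self (ε τ : ℝ) (X : ℝ → Rˣ) :
    IsApproxFundamentalSolOn A V ε (Icc τ τ) X := by
  rintro σ hσ
  obtain rfl : σ = τ := by simpa using hσ
  rw [Icc_self, nhdsWithin_singleton]
  simp [isBigOWith_iff]

section Reflection

open scoped Pointwise

theorem tendsto_neg_nhdsWithin_preimage (S : Set ℝ) (τ : ℝ) :
    Tendsto (fun t : ℝ => -t) (𝓝[S] τ) (𝓝[-S] (-τ)) :=
  tendsto_nhdsWithin_iff.2 ⟨(continuous_neg.tendsto τ).mono_left nhdsWithin_le_nhds,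
    eventually_mem_nhdsWithin.mono fun t ht => by simpa using ht⟩

theorem IsRegularIntegrator.reflect (h : IsRegularIntegrator A V) :
    IsRegularIntegrator (fun t => A (-t)) fun t => -V (-t) where
  mono _ _ hst := neg_le_neg (h.mono (neg_le_neg hst))
  norm_sub_le s t := by
    rw [neg_sub_neg, abs_sub_comm]
    exact h.norm_sub_le (-s) (-t)
  right τ := (h.left (-τ)).imp fun _ hL => ⟨hL.1.comp tendsto_neg_nhdsGT, hL.2⟩
  left τ := (h.right (-τ)).imp fun _ hL => ⟨hL.1.comp tendsto_neg_nhdsLT, hL.2⟩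

theorem IsApproxFundamentalSolOn.of_reflect {ε : ℝ} {S : Set ℝ} {X : ℝ → Rˣ}
    (h : IsApproxFundamentalSolOn (fun t => A (-t)) (fun t => -V (-t)) ε (-S) X) :
    IsApproxFundamentalSolOn A V ε S fun t => X (-t) := by
  intro τ hτ
  have := ((h (-τ) (by simpa using hτ)).comp_tendsto
    (tendsto_neg_nhdsWithin_preimage S τ)).neg_right
  simpa only [Function.comp_def, neg_neg, neg_sub_neg, neg_sub] using this

theorem IsTransitionBoundOn.of_reflect {C : ℝ} {S : Set ℝ} {X : ℝ → Rˣ}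
    (h : IsTransitionBoundOn C (-S) X) : IsTransitionBoundOn C S fun t => X (-t) :=
  fun s hs t ht => h (-s) (by simpa using hs) (-t) (by simpa using ht)

end Reflection

section Glue

/-- `X` up to time `b`, continued by `Y` with matching value at `b`. -/
noncomputable def glueAt (b : ℝ) (X Y : ℝ → Rˣ) (t : ℝ) : Rˣ :=
  if t ≤ b then X t else Y t / Y b * X b

variable {b : ℝ} {X Y : ℝ → Rˣ}

theorem glueAt_of_le {t : ℝ} (ht : t ≤ b) : glueAt b X Y t = X t := if_pos ht

theorem glueAt_of_ge {t : ℝ} (ht : b ≤ t) : glueAt b X Y t = Y t / Y b * X b := by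
  rcases ht.eq_or_lt with rfl | ht
  · simp [glueAt]
  · exact if_neg ht.not_ge

theorem glueAt_div_of_ge {s t : ℝ} (hs : b ≤ s) (ht : b ≤ t) :
    glueAt b X Y t / glueAt b X Y s = Y t / Y s := by
  rw [glueAt_of_ge hs, glueAt_of_ge ht, mul_div_mul_right_eq_div, div_div_div_cancel_right]

theorem IsApproxFundamentalSolOn.glue {ε a c : ℝ}
    (hX : IsApproxFundamentalSolOn A V ε (Icc a b) X)
    (hY : IsApproxFundamentalSolOn A V ε (Icc b c) Y) (hab : a ≤ b) (hbc : b ≤ c) :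
    IsApproxFundamentalSolOn A V ε (Icc a c) (glueAt b X Y) := by
  have left : ∀ τ ∈ Icc a b, IsBigOWith ε (𝓝[Icc a b] τ)
      (fun t => ((glueAt b X Y t / glueAt b X Y τ : Rˣ) : R) - (1 + (A t - A τ)))
      fun t => V t - V τ := fun τ hτ =>
    (hX τ hτ).congr' rfl (eventually_mem_nhdsWithin.mono fun t ht => by
      simp only [glueAt_of_le ht.2, glueAt_of_le hτ.2]) .rfl
  have right : ∀ τ ∈ Icc b c, IsBigOWith ε (𝓝[Icc b c] τ)
      (fun t => ((glueAt b X Y t / glueAt b X Y τ : Rˣ) : R) - (1 + (A t - A τ)))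
      fun t => V t - V τ := fun τ hτ =>
    (hY τ hτ).congr' rfl (eventually_mem_nhdsWithin.mono fun t ht => by
      simp only [glueAt_div_of_ge hτ.1 ht.1]) .rfl
  intro τ hτ
  rcases lt_trichotomy τ b with h | rfl | h
  · refine (left τ ⟨hτ.1, h.le⟩).mono (nhdsWithin_le_of_mem ?_)
    filter_upwards [self_mem_nhdsWithin, mem_nhdsWithin_of_mem_nhds (Iio_mem_nhds h)] with t ht htb
      using ⟨ht.1, le_of_lt htb⟩
  · rw [← Icc_union_Icc_eq_Icc hab hbc, nhdsWithin_union]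
    exact (left τ ⟨hab, le_rfl⟩).sup (right τ ⟨le_rfl, hbc⟩)
  · refine (right τ ⟨h.le, hτ.2⟩).mono (nhdsWithin_le_of_mem ?_)
    filter_upwards [self_mem_nhdsWithin, mem_nhdsWithin_of_mem_nhds (Ioi_mem_nhds h)] with t ht htb
      using ⟨le_of_lt htb, ht.2⟩

theorem IsTransitionBoundOn.glue {C C' a c : ℝ} (hX : IsTransitionBoundOn C (Icc a b) X)
    (hY : IsTransitionBoundOn C' (Icc b c) Y) (hab : a ≤ b) (hbc : b ≤ c) :
    IsTransitionBoundOn (max (max C C') (C * C')) (Icc a c) (glueAt b X Y) := by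
  have hbX : b ∈ Icc a b := ⟨hab, le_rfl⟩
  have hbY : b ∈ Icc b c := ⟨le_rfl, hbc⟩
  intro s hs t ht
  rcases le_total s b with hsb | hsb <;> rcases le_total t b with htb | htb
  · rw [glueAt_of_le hsb, glueAt_of_le htb]
    exact (hX s ⟨hs.1, hsb⟩ t ⟨ht.1, htb⟩).trans ((le_max_left _ _).trans (le_max_left _ _))
  · rw [glueAt_of_le hsb, glueAt_of_ge htb, mul_div_assoc, Units.val_mul, mul_comm C]
    exact (norm_mul_le_of_le (hY b hbY t ⟨htb, ht.2⟩) (hX s ⟨hs.1, hsb⟩ b hbX)).trans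
      (le_max_right _ _)
  · have split : X t / (Y s / Y b * X b) = (X t / X b) * (Y b / Y s) := by
      simp only [div_eq_mul_inv, mul_inv_rev, inv_inv, mul_assoc]
    rw [glueAt_of_ge hsb, glueAt_of_le htb, split, Units.val_mul]
    exact (norm_mul_le_of_le (hX b hbX t ⟨ht.1, htb⟩) (hY s ⟨hsb, hs.2⟩ b hbY)).trans
      (le_max_right _ _)
  · rw [glueAt_div_of_ge hsb htb]
    exact (hY s ⟨hsb, hs.2⟩ t ⟨htb, ht.2⟩).trans ((le_max_right _ _).trans (le_max_left _ _))

end Glue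

section Local

theorem exists_units_tendsto_one [CompleteSpace R] {α : Type*} {l : Filter α} {f : α → R}
    (hf : Tendsto f l (𝓝 1)) :
    ∃ u : α → Rˣ, Tendsto u l (𝓝 1) ∧ ∀ᶠ x in l, (u x : R) = f x := by
  have isUnit : ∀ᶠ x in l, IsUnit (f x) := hf.eventually (Units.isOpen.mem_nhds isUnit_one)
  have lift : ∀ x, ∃ u : Rˣ, IsUnit (f x) → (u : R) = f x := fun x => by
    by_cases h : IsUnit (f x)
    · exact ⟨h.unit, fun _ => h.unit_spec⟩
    · exact ⟨1, fun h' => absurd h' h⟩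
  choose u hu using lift
  have val : ∀ᶠ x in l, (u x : R) = f x := isUnit.mono hu
  refine ⟨u, Units.isOpenEmbedding_val.tendsto_nhds_iff.2 ?_, val⟩
  simpa only [Function.comp_def, Units.val_one] using hf.congr' (val.mono fun x hx => hx.symm)

theorem norm_jumpGT_le (hV : Monotone V) (hA : ∀ s t, ‖A t - A s‖ ≤ |V t - V s|) {τ t : ℝ} {L : R}
    (hL : Tendsto A (𝓝[>] τ) (𝓝 L)) (ht : τ < t) : ‖L - A τ‖ ≤ |V t - V τ| := by
  refine le_of_tendsto (hL.sub_const (A τ)).norm ?_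
  filter_upwards [Ioc_mem_nhdsGT ht] with s hs
  refine (hA τ s).trans (abs_le_abs_of_nonneg (sub_nonneg.2 (hV hs.1.le)) ?_)
  exact sub_le_sub_right (hV hs.2) _

theorem norm_mul_sub_one_add_le {u D x y L : R} (hu : u = 1 + (x - L)) (hD : D = 1 + (L - y)) :
    ‖u * D - (1 + (x - y))‖ ≤ ‖x - L‖ * ‖L - y‖ := by
  have expand : u * D - (1 + (x - y)) = (x - L) * (L - y) := by
    rw [hu, hD]
    noncomm_ring
  rw [expand]
  exact norm_mul_le _ _

theorem norm_div_sub_one_add_le {u v : Rˣ} {x : R} (h : (u : R) - v = x) :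
    ‖((u / v : Rˣ) : R) - (1 + x)‖ ≤ ‖x‖ * ‖((v⁻¹ : Rˣ) : R) - 1‖ := by
  have expand : ((u / v : Rˣ) : R) - (1 + x) = x * (((v⁻¹ : Rˣ) : R) - 1) := by
    rw [← h, div_eq_mul_inv, Units.val_mul, mul_sub, sub_mul, v.mul_inv, mul_one]
    abel
  rw [expand]
  exact norm_mul_le _ _

theorem eventually_forall_Ioc {p : ℝ → Prop} {τ : ℝ} (h : ∀ᶠ t in 𝓝[>] τ, p t) :
    ∀ᶠ b in 𝓝[>] τ, ∀ t ∈ Ioc τ b, p t := by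
  obtain ⟨u, hu, hp⟩ := mem_nhdsGT_iff_exists_Ioc_subset.1 h
  filter_upwards [Ioc_mem_nhdsGT hu] with b hb t ht using hp ⟨ht.1, ht.2.trans hb.2⟩

/-- With `L = A(τ⁺)`, the factor `D` is the jump at `τ` and `u t` the motion after it. -/
theorem isApproxFundamentalSolOn_explicit (hV : Monotone V)
    (hA : ∀ s t, ‖A t - A s‖ ≤ |V t - V s|) {τ : ℝ} {L : R} (hL : Tendsto A (𝓝[>] τ) (𝓝 L))
    {D : Rˣ} (hD : (D : R) = 1 + (L - A τ)) {u : ℝ → Rˣ} (hu : Tendsto u (𝓝[>] τ) (𝓝 1))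
    (hu_val : ∀ᶠ t in 𝓝[>] τ, (u t : R) = 1 + (A t - L)) {ε : ℝ} (hε : 0 < ε) :
    ∀ᶠ b in 𝓝[>] τ,
      IsApproxFundamentalSolOn A V ε (Icc τ b) fun t => if t = τ then 1 else u t * D := by
  have near_limit : ∀ᶠ t in 𝓝[>] τ, ‖A t - L‖ ≤ ε :=
    ((tendsto_iff_norm_sub_tendsto_zero.1 hL).eventually_lt_const hε).mono fun _ => le_of_lt
  have near_one : ∀ᶠ t in 𝓝[>] τ, ‖(((u t)⁻¹ : Rˣ) : R) - 1‖ ≤ ε := by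
    have : Tendsto (fun t => (((u t)⁻¹ : Rˣ) : R)) (𝓝[>] τ) (𝓝 1) := by
      simpa [Function.comp_def] using (Units.continuous_val.tendsto _).comp hu.inv
    exact ((tendsto_iff_norm_sub_tendsto_zero.1 this).eventually_lt_const hε).mono fun _ => le_of_lt
  filter_upwards [eventually_forall_Ioc (near_limit.and (near_one.and hu_val))] with b hb σ hσ
  rw [isBigOWith_iff]
  rcases hσ.1.eq_or_lt with rfl | hτσ
  · filter_upwards [self_mem_nhdsWithin] with t ht
    rcases ht.1.eq_or_lt with rfl | hτt
    · simp
    obtain ⟨hAt, -, hut⟩ := hb t ⟨hτt, ht.2⟩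
    rw [if_neg hτt.ne', if_pos rfl, div_one, Units.val_mul]
    exact (norm_mul_sub_one_add_le hut hD).trans
      (mul_le_mul hAt (norm_jumpGT_le hV hA hL hτt) (norm_nonneg _) hε.le)
  · filter_upwards [self_mem_nhdsWithin, mem_nhdsWithin_of_mem_nhds (Ioi_mem_nhds hτσ)]
      with t ht hτt
    obtain ⟨-, huσ, hσ_val⟩ := hb σ ⟨hτσ, hσ.2⟩
    obtain ⟨-, -, ht_val⟩ := hb t ⟨hτt, ht.2⟩
    rw [if_neg (ne_of_gt hτt), if_neg hτσ.ne', mul_div_mul_right_eq_div, mul_comm]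
    refine (norm_div_sub_one_add_le ?_).trans
      (mul_le_mul (hA σ t) huσ (norm_nonneg _) (abs_nonneg _))
    rw [ht_val, hσ_val]
    abel

theorem exists_isTransitionBoundOn_of_tendsto {X : ℝ → Rˣ} {D : Rˣ} {τ : ℝ}
    (hX : Tendsto X (𝓝[>] τ) (𝓝 D)) :
    ∃ C, ∀ᶠ b in 𝓝[>] τ, IsTransitionBoundOn C (Icc τ b) X := by
  have bound : ∀ {Y : ℝ → Rˣ} {E : Rˣ}, Tendsto Y (𝓝[>] τ) (𝓝 E) →
      ∃ C : ℝ, ∀ᶠ b in 𝓝[>] τ, ∀ t ∈ Icc τ b, ‖(Y t : R)‖ ≤ C := fun {Y E} hY => by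
    have lim := ((Units.continuous_val.tendsto _).comp hY).norm.eventually_lt_const (lt_add_one _)
    refine ⟨max ‖(Y τ : R)‖ (‖(E : R)‖ + 1), (eventually_forall_Ioc lim).mono fun b hb t ht => ?_⟩
    rcases ht.1.eq_or_lt with rfl | hτt
    · exact le_max_left _ _
    · exact (hb t ⟨hτt, ht.2⟩).le.trans (le_max_right _ _)
  obtain ⟨C, hC⟩ := bound hX
  obtain ⟨C', hC'⟩ := bound hX.inv
  refine ⟨C * C', (hC.and hC').mono fun b hb s hs t ht => ?_⟩
  rw [div_eq_mul_inv, Units.val_mul]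
  exact norm_mul_le_of_le (hb.1 t ht) (hb.2 s hs)

theorem IsRegularIntegrator.exists_local [CompleteSpace R] (h : IsRegularIntegrator A V) (τ : ℝ) :
    ∃ (X : ℝ → Rˣ) (C : ℝ), ∀ ε > 0, ∀ᶠ b in 𝓝[>] τ,
      IsApproxFundamentalSolOn A V ε (Icc τ b) X ∧ IsTransitionBoundOn C (Icc τ b) X := by
  obtain ⟨L, hL, D, hD⟩ := h.right τ
  obtain ⟨u, hu, hu_val⟩ := exists_units_tendsto_one (f := fun t => 1 + (A t - L)) (l := 𝓝[>] τ)
    (by simpa using (hL.sub_const L).const_add 1)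
  have lim : Tendsto (fun t => if t = τ then 1 else u t * D) (𝓝[>] τ) (𝓝 (1 * D)) :=
    (hu.mul_const D).congr' (eventually_mem_nhdsWithin.mono fun t ht => (if_neg (ne_of_gt ht)).symm)
  obtain ⟨C, hC⟩ := exists_isTransitionBoundOn_of_tendsto lim
  exact ⟨_, C, fun ε hε =>
    (isApproxFundamentalSolOn_explicit h.mono h.norm_sub_le hL hD hu hu_val hε).and hC⟩

end Local

section Gronwall

theorem norm_mul_sub_one_le (x y : R) : ‖x * y - 1‖ ≤ (‖x - 1‖ + 1) * (‖y - 1‖ + 1) - 1 := by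
  have split : x * y - 1 = (x - 1) * (y - 1) + (x - 1) + (y - 1) := by noncomm_ring
  rw [split]
  linarith [norm_add₃_le (a := (x - 1) * (y - 1)) (b := x - 1) (c := y - 1),
    norm_mul_le (x - 1) (y - 1)]

theorem norm_units_inv_sub_one_le (u : Rˣ) {q : ℝ} (hq : q ≤ 1 / 2) (hu : ‖(u : R) - 1‖ ≤ q) :
    ‖((u⁻¹ : Rˣ) : R) - 1‖ ≤ 2 * q := by
  have split : ((u⁻¹ : Rˣ) : R) - 1 = -((↑u⁻¹ - 1) * (u - 1)) - (u - 1) := by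
    simp only [sub_mul, mul_sub, u.inv_mul, mul_one, one_mul]
    abel
  have bound : ‖((u⁻¹ : Rˣ) : R) - 1‖ ≤ ‖((u⁻¹ : Rˣ) : R) - 1‖ * ‖(u : R) - 1‖ + ‖(u : R) - 1‖ := by
    conv_lhs => rw [split]
    refine (norm_sub_le _ _).trans ?_
    gcongr
    exact (norm_neg _).trans_le (norm_mul_le _ _)
  nlinarith [norm_nonneg (((u⁻¹ : Rˣ) : R) - 1)]

theorem IsApproxFundamentalSolOn.eventually_norm_div_sub_one_le {ε : ℝ} {S : Set ℝ} {X : ℝ → Rˣ}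
    (hA : ∀ s t, ‖A t - A s‖ ≤ |V t - V s|) (hX : IsApproxFundamentalSolOn A V ε S X)
    (hε : ε ≤ 1) (hsmall : ∀ s ∈ S, ∀ t ∈ S, |V t - V s| ≤ 1 / 4) {τ : ℝ} (hτ : τ ∈ S) :
    ∀ᶠ t in 𝓝[S] τ, ‖((X t / X τ : Rˣ) : R) - 1‖ ≤ 4 * |V t - V τ| ∧
      ‖((X τ / X t : Rˣ) : R) - 1‖ ≤ 4 * |V t - V τ| := by
  filter_upwards [(hX τ hτ).bound, self_mem_nhdsWithin] with t ht htS
  have hsmall := hsmall τ hτ t htS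
  have step : ‖((X t / X τ : Rˣ) : R) - 1‖ ≤ 2 * |V t - V τ| :=
    calc _ = ‖(((X t / X τ : Rˣ) : R) - (1 + (A t - A τ))) + (A t - A τ)‖ := by congr 1; abel
      _ ≤ ε * |V t - V τ| + |V t - V τ| := norm_add_le_of_le ht (hA τ t)
      _ ≤ 2 * |V t - V τ| := by nlinarith [abs_nonneg (V t - V τ)]
  have inv := norm_units_inv_sub_one_le _ (by linarith) step
  rw [inv_div] at inv
  exact ⟨step.trans (by linarith [abs_nonneg (V t - V τ)]), inv.trans_eq (by ring)⟩

theorem IsApproxFundamentalSolOn.norm_div_sub_one_le (hV : Monotone V)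
    (hA : ∀ s t, ‖A t - A s‖ ≤ |V t - V s|) {ε a b : ℝ} {X : ℝ → Rˣ}
    (hX : IsApproxFundamentalSolOn A V ε (Icc a b) X) (hε : ε ≤ 1) (hsmall : V b - V a ≤ 1 / 4)
    (hab : a ≤ b) :
    ‖((X b / X a : Rˣ) : R) - 1‖ ≤ Real.exp (4 * (V b - V a)) - 1 ∧
      ‖((X a / X b : Rˣ) : R) - 1‖ ≤ Real.exp (4 * (V b - V a)) - 1 := by
  have hsmall' : ∀ s ∈ Icc a b, ∀ t ∈ Icc a b, |V t - V s| ≤ 1 / 4 := fun s hs t ht =>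
    abs_sub_le_iff.2 ⟨by linarith [hV ht.2, hV hs.1], by linarith [hV hs.2, hV ht.1]⟩
  have local_bound : ∀ τ ∈ Icc a b, ∀ᶠ t in 𝓝[Icc a b] τ,
      ‖((X t / X τ : Rˣ) : R) - 1‖ ≤ Real.exp (4 * |V t - V τ|) - 1 ∧
      ‖((X τ / X t : Rˣ) : R) - 1‖ ≤ Real.exp (4 * |V t - V τ|) - 1 := fun τ hτ =>
    (hX.eventually_norm_div_sub_one_le hA hε hsmall' hτ).mono fun t ht =>
      ⟨ht.1.trans (le_sub_iff_add_le.2 (Real.add_one_le_exp _)),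
        ht.2.trans (le_sub_iff_add_le.2 (Real.add_one_le_exp _))⟩
  refine cousin_induction (P := fun x y =>
    ‖((X y / X x : Rˣ) : R) - 1‖ ≤ Real.exp (4 * (V y - V x)) - 1 ∧
      ‖((X x / X y : Rˣ) : R) - 1‖ ≤ Real.exp (4 * (V y - V x)) - 1) hab (by simp) ?_ ?_ ?_
  · rintro x y z _ _ _ _ ⟨hyx, hxy⟩ ⟨hzy, hyz⟩
    have exp_add : Real.exp (4 * (V z - V x))
        = Real.exp (4 * (V z - V y)) * Real.exp (4 * (V y - V x)) := by
      rw [← Real.exp_add]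
      ring_nf
    rw [exp_add, ← div_mul_div_cancel (X z) (X y) (X x), ← div_mul_div_cancel (X x) (X y) (X z),
      Units.val_mul, Units.val_mul]
    have mul_le {p q : R} {c d : ℝ} (hp : ‖p - 1‖ ≤ c - 1) (hq : ‖q - 1‖ ≤ d - 1) :
        ‖p * q - 1‖ ≤ c * d - 1 := by
      refine (norm_mul_sub_one_le p q).trans (sub_le_sub_right ?_ 1)
      have := norm_nonneg (p - 1)
      exact mul_le_mul (by linarith) (by linarith) (by positivity) (by linarith)
    exact ⟨mul_le hzy hyx, (mul_le hxy hyz).trans_eq (by rw [mul_comm])⟩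
  · intro τ hτ
    filter_upwards [nhdsGT_le_nhdsWithin_Icc hτ (local_bound τ (Ico_subset_Icc_self hτ)),
      self_mem_nhdsWithin] with t ht hτt
    rwa [abs_of_nonneg (sub_nonneg.2 (hV (le_of_lt hτt)))] at ht
  · intro τ hτ
    filter_upwards [nhdsLT_le_nhdsWithin_Icc hτ (local_bound τ (Ioc_subset_Icc_self hτ)),
      self_mem_nhdsWithin] with t ht htτ
    rw [abs_sub_comm, abs_of_nonneg (sub_nonneg.2 (hV (le_of_lt htτ)))] at ht
    exact ht.symm

theorem IsApproxFundamentalSolOn.isTransitionBoundOn (hV : Monotone V)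
    (hA : ∀ s t, ‖A t - A s‖ ≤ |V t - V s|) {ε a b : ℝ}
    {X : ℝ → Rˣ} (hX : IsApproxFundamentalSolOn A V ε (Icc a b) X) (hε : ε ≤ 1)
    (hsmall : V b - V a ≤ 1 / 4) :
    IsTransitionBoundOn (Real.exp 1 - 1 + ‖(1 : R)‖) (Icc a b) X := by
  intro s hs t ht
  have bound {x : R} {c : ℝ} (hx : ‖x - 1‖ ≤ Real.exp (4 * c) - 1) (hc : c ≤ 1 / 4) :
      ‖x‖ ≤ Real.exp 1 - 1 + ‖(1 : R)‖ := by
    have : Real.exp (4 * c) ≤ Real.exp 1 := Real.exp_le_exp.2 (by linarith)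
    linarith [norm_le_norm_sub_add x 1]
  rcases le_total s t with hst | hts
  · have := hV hs.1
    have := hV ht.2
    exact bound ((hX.mono (Icc_subset_Icc hs.1 ht.2)).norm_div_sub_one_le hV hA hε
      (by linarith) hst).1 (by linarith)
  · have := hV ht.1
    have := hV hs.2
    exact bound ((hX.mono (Icc_subset_Icc ht.1 hs.2)).norm_div_sub_one_le hV hA hε
      (by linarith) hts).2 (by linarith)

end Gronwall

section Existence

open scoped Pointwise

/-- Approximate solutions of arbitrary precision exist with transition operators bounded
independently of the precision. -/
def HasBoundedApproxSolOn (A : ℝ → R) (V : ℝ → ℝ) (S : Set ℝ) : Prop :=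
  ∃ C, ∀ ε > 0, ∃ X, IsApproxFundamentalSolOn A V ε S X ∧ IsTransitionBoundOn C S X

theorem HasBoundedApproxSolOn.of_reflect {S : Set ℝ}
    (h : HasBoundedApproxSolOn (fun t => A (-t)) (fun t => -V (-t)) (-S)) :
    HasBoundedApproxSolOn A V S := by
  obtain ⟨C, hC⟩ := h
  refine ⟨C, fun ε hε => ?_⟩
  obtain ⟨X, hX, hXC⟩ := hC ε hε
  exact ⟨_, hX.of_reflect, hXC.of_reflect⟩

variable [CompleteSpace R]

theorem IsRegularIntegrator.exists_isApproxFundamentalSolOn (h : IsRegularIntegrator A V)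
    {ε : ℝ} (hε : 0 < ε) {a b : ℝ} (hab : a ≤ b) :
    ∃ X, IsApproxFundamentalSolOn A V ε (Icc a b) X := by
  refine cousin_induction (P := fun x y => ∃ X, IsApproxFundamentalSolOn A V ε (Icc x y) X) hab
    (fun τ _ => ⟨1, isApproxFundamentalSolOn_Icc_self ε τ 1⟩) ?_ (fun τ _ => ?_) fun τ _ => ?_
  · rintro x y z _ hxy hyz _ ⟨X, hX⟩ ⟨Y, hY⟩
    exact ⟨_, hX.glue hY hxy hyz⟩
  · obtain ⟨X, C, hX⟩ := h.exists_local τ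
    exact (hX ε hε).mono fun t ht => ⟨X, ht.1⟩
  · obtain ⟨X, C, hX⟩ := h.reflect.exists_local (-τ)
    filter_upwards [tendsto_neg_nhdsLT.eventually (hX ε hε)] with t ht
    exact ⟨_, .of_reflect (by simpa only [neg_Icc] using ht.1)⟩

theorem IsRegularIntegrator.eventually_hasBoundedApproxSolOn (h : IsRegularIntegrator A V)
    (τ : ℝ) : ∀ᶠ t in 𝓝[>] τ, HasBoundedApproxSolOn A V (Icc τ t) := by
  obtain ⟨X, C, hX⟩ := h.exists_local τ
  set C' : ℝ := Real.exp 1 - 1 + ‖(1 : R)‖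
  have hV : ∀ᶠ t in 𝓝[>] τ, ∀ γ ∈ Ioo τ t, V t - V γ ≤ 1 / 4 := by
    set v := sInf (V '' Ioi τ)
    have hv : Tendsto V (𝓝[>] τ) (𝓝 v) := h.mono.tendsto_nhdsGT τ
    have hlt : v < v + 1 / 4 := by norm_num
    filter_upwards [hv.eventually (gt_mem_nhds hlt)] with t ht γ hγ
    have : v ≤ V γ :=
      le_of_tendsto hv (mem_of_superset (Ioo_mem_nhdsGT hγ.1) fun s hs => h.mono hs.2.le)
    linarith
  filter_upwards [hV, self_mem_nhdsWithin] with t hVt hτt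
  refine ⟨max (max C C') (C * C'), fun ε hε => ?_⟩
  obtain ⟨γ, hγ, hXγ, hXC⟩ :=
    ((eventually_mem_set.2 (Ioo_mem_nhdsGT hτt)).and (hX _ (lt_min hε one_pos))).exists
  obtain ⟨Y, hY⟩ := h.exists_isApproxFundamentalSolOn (lt_min hε one_pos) hγ.2.le
  refine ⟨_, (hXγ.glue hY hγ.1.le hγ.2.le).weaken (min_le_left _ _),
    hXC.glue (hY.isTransitionBoundOn h.mono h.norm_sub_le (min_le_right _ _) (hVt γ hγ))
      hγ.1.le hγ.2.le⟩

theorem IsRegularIntegrator.hasBoundedApproxSolOn (h : IsRegularIntegrator A V) {a b : ℝ}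
    (hab : a ≤ b) : HasBoundedApproxSolOn A V (Icc a b) := by
  refine cousin_induction (P := fun x y => HasBoundedApproxSolOn A V (Icc x y)) hab
    (fun τ _ => ⟨‖(1 : R)‖, fun ε _ => ⟨1, isApproxFundamentalSolOn_Icc_self ε τ 1, ?_⟩⟩)
    ?_ (fun τ _ => h.eventually_hasBoundedApproxSolOn τ) fun τ _ => ?_
  · intro s _ t _
    simp
  · rintro x y z _ hxy hyz _ ⟨C, hC⟩ ⟨C', hC'⟩
    refine ⟨max (max C C') (C * C'), fun ε hε => ?_⟩
    obtain ⟨X, hX, hXC⟩ := hC ε hε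
    obtain ⟨Y, hY, hYC⟩ := hC' ε hε
    exact ⟨_, hX.glue hY hxy hyz, hXC.glue hYC hxy hyz⟩
  · filter_upwards [tendsto_neg_nhdsLT.eventually (h.reflect.eventually_hasBoundedApproxSolOn (-τ))]
      with t ht
    exact .of_reflect (by simpa only [neg_Icc] using ht)

end Existence

section Limit

/-- The operators `(X a / X t) (Y t / Y a)` vary little, since `X` and `Y` have nearly the same
infinitesimal transitions. -/
theorem IsApproxFundamentalSolOn.norm_div_sub_div_le (hV : Monotone V) {a b C ε ε' : ℝ}
    {X Y : ℝ → Rˣ} (hX : IsApproxFundamentalSolOn A V ε (Icc a b) X)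
    (hY : IsApproxFundamentalSolOn A V ε' (Icc a b) Y) (hXC : IsTransitionBoundOn C (Icc a b) X)
    (hYC : IsTransitionBoundOn C (Icc a b) Y) {s t : ℝ} (hs : s ∈ Icc a b) (ht : t ∈ Icc a b) :
    ‖((Y t / Y s : Rˣ) : R) - ((X t / X s : Rˣ) : R)‖ ≤ C ^ 4 * (ε + ε') * |V t - V s| := by
  have ha : a ∈ Icc a b := ⟨le_rfl, hs.1.trans hs.2⟩
  have norm_sandwich {x z : ℝ} (hx : x ∈ Icc a b) (hz : z ∈ Icc a b) {y : R} {c : ℝ} (hy : ‖y‖ ≤ c)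
      (x' z' : ℝ) (hx' : x' ∈ Icc a b) (hz' : z' ∈ Icc a b) :
      ‖((X x / X x' : Rˣ) : R) * y * ((Y z / Y z' : Rˣ) : R)‖ ≤ C * c * C :=
    norm_mul_le_of_le (norm_mul_le_of_le (hXC x' hx' x hx) hy) (hYC z' hz' z hz)
  set Z : ℝ → R := fun t => ((X a / X t * (Y t / Y a) : Rˣ) : R) with hZ
  have Z_sub (p q : ℝ) : Z p - Z q = ((X a / X p : Rˣ) : R) *
      (((Y p / Y q : Rˣ) : R) - ((X p / X q : Rˣ) : R)) * ((Y q / Y a : Rˣ) : R) := by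
    simp only [hZ, mul_sub, sub_mul, ← Units.val_mul, mul_assoc, div_mul_div_cancel]
  have Z_loc : ∀ τ ∈ Icc a b, IsBigOWith (C ^ 2 * (ε + ε')) (𝓝[Icc a b] τ)
      (fun t => Z t - Z τ) fun t => V t - V τ := fun τ hτ => by
    have diff := (hY τ hτ).sub (hX τ hτ)
    simp only [sub_sub_sub_cancel_right] at diff
    refine isBigOWith_iff.2 ?_
    filter_upwards [diff.bound, self_mem_nhdsWithin] with t ht htI
    rw [Z_sub]
    exact (norm_sandwich ha hτ ht t a htI ha).trans_eq (by ring)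
  have unsandwich : ((Y t / Y s : Rˣ) : R) - ((X t / X s : Rˣ) : R)
      = ((X t / X a : Rˣ) : R) * (Z t - Z s) * ((Y a / Y s : Rˣ) : R) := by
    simp only [hZ, mul_sub, sub_mul, ← Units.val_mul, mul_assoc, div_mul_div_cancel]
    simp only [← mul_assoc, div_mul_div_cancel, div_self', one_mul, mul_one]
  rw [unsandwich]
  exact (norm_sandwich ht ha (norm_sub_le_of_isBigOWith hV Z_loc hs ht) a s ha hs).trans_eq
    (by ring)

theorem isFundamentalSolOn_of_tendsto (hV : Monotone V) {a b C : ℝ} {e : ℕ → ℝ}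
    (he : Tendsto e atTop (𝓝 0)) {X : ℕ → ℝ → Rˣ} {Y : ℝ → Rˣ}
    (hX : ∀ k, IsApproxFundamentalSolOn A V (e k) (Icc a b) (X k))
    (hC : ∀ k, IsTransitionBoundOn C (Icc a b) (X k))
    (hY : ∀ s ∈ Icc a b, ∀ t ∈ Icc a b,
      Tendsto (fun k => ((X k t / X k s : Rˣ) : R)) atTop (𝓝 ((Y t / Y s : Rˣ) : R))) :
    IsFundamentalSolOn A V (Icc a b) Y := by
  have close : ∀ k, ∀ s ∈ Icc a b, ∀ t ∈ Icc a b,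
      ‖((Y t / Y s : Rˣ) : R) - ((X k t / X k s : Rˣ) : R)‖ ≤ C ^ 4 * e k * |V t - V s| := by
    intro k s hs t ht
    have lim : Tendsto (fun m => C ^ 4 * (e k + e m) * |V t - V s|) atTop
        (𝓝 (C ^ 4 * (e k + 0) * |V t - V s|)) :=
      ((he.const_add (e k)).const_mul _).mul_const _
    rw [add_zero] at lim
    exact le_of_tendsto_of_tendsto' ((hY s hs t ht).sub_const _).norm lim fun m =>
      (hX k).norm_div_sub_div_le hV (hX m) (hC k) (hC m) hs ht
  refine isFundamentalSolOn_iff.2 fun ε hε τ hτ => ?_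
  have lim : Tendsto (fun k => C ^ 4 * e k + e k) atTop (𝓝 0) := by
    simpa using (he.const_mul (C ^ 4)).add he
  obtain ⟨k, hk⟩ := (lim.eventually_lt_const hε).exists
  have near : IsBigOWith (C ^ 4 * e k) (𝓝[Icc a b] τ)
      (fun t => ((Y t / Y τ : Rˣ) : R) - ((X k t / X k τ : Rˣ) : R)) fun t => V t - V τ :=
    isBigOWith_iff.2 (eventually_mem_nhdsWithin.mono fun t ht => close k τ hτ t ht)
  exact ((near.add (hX k τ hτ)).congr_left fun t => sub_add_sub_cancel _ _ _).weaken hk.le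

variable [CompleteSpace R]

theorem exists_units_tendsto {x : ℕ → Rˣ} (hx : CauchySeq fun k => (x k : R))
    (hx' : CauchySeq fun k => (((x k)⁻¹ : Rˣ) : R)) : ∃ u : Rˣ, Tendsto x atTop (𝓝 u) := by
  obtain ⟨u, hu⟩ := cauchySeq_tendsto_of_complete hx
  obtain ⟨w, hw⟩ := cauchySeq_tendsto_of_complete hx'
  have huw : u * w = 1 := tendsto_nhds_unique (hu.mul hw) (by simp)
  have hwu : w * u = 1 := tendsto_nhds_unique (hw.mul hu) (by simp)
  exact ⟨⟨u, w, huw, hwu⟩, Units.isOpenEmbedding_val.tendsto_nhds_iff.2 hu⟩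

theorem exists_tendsto_div (hV : Monotone V) {a b C : ℝ} {e : ℕ → ℝ} (he_anti : Antitone e)
    (he : Tendsto e atTop (𝓝 0)) {X : ℕ → ℝ → Rˣ}
    (hX : ∀ k, IsApproxFundamentalSolOn A V (e k) (Icc a b) (X k))
    (hC : ∀ k, IsTransitionBoundOn C (Icc a b) (X k)) {s t : ℝ} (hs : s ∈ Icc a b)
    (ht : t ∈ Icc a b) : ∃ u : Rˣ, Tendsto (fun k => X k t / X k s) atTop (𝓝 u) := by
  have cauchy {p q : ℝ} (hp : p ∈ Icc a b) (hq : q ∈ Icc a b) :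
      CauchySeq fun k => ((X k p / X k q : Rˣ) : R) := by
    have lim : Tendsto (fun N => C ^ 4 * (e N + e N) * |V p - V q|) atTop (𝓝 0) := by
      simpa using ((he.add he).const_mul (C ^ 4)).mul_const |V p - V q|
    refine cauchySeq_of_le_tendsto_0 _ (fun m k N hm hk => ?_) lim
    rw [dist_eq_norm]
    refine ((hX k).norm_div_sub_div_le hV (hX m) (hC k) (hC m) hq hp).trans ?_
    have := he_anti hm
    have := he_anti hk
    gcongr
  exact exists_units_tendsto (cauchy ht hs) (by simpa only [inv_div] using cauchy hs ht)

theorem IsRegularIntegrator.exists_isFundamentalSolOn_Icc (h : IsRegularIntegrator A V) {a b : ℝ}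
    (hab : a ≤ b) :
    ∃ X C, IsFundamentalSolOn A V (Icc a b) X ∧ IsTransitionBoundOn C (Icc a b) X := by
  obtain ⟨C, hC⟩ := h.hasBoundedApproxSolOn hab
  set e : ℕ → ℝ := fun k => 1 / ((k : ℝ) + 1)
  have he : Tendsto e atTop (𝓝 0) := tendsto_one_div_add_atTop_nhds_zero_nat
  have he_anti : Antitone e := fun k m hkm => by simp only [e]; gcongr
  choose X hX hXC using fun k : ℕ => hC (e k) (by simp only [e]; positivity)
  have conv : ∀ t, ∃ u : Rˣ, t ∈ Icc a b → Tendsto (fun k => X k t / X k a) atTop (𝓝 u) := by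
    intro t
    by_cases ht : t ∈ Icc a b
    · exact (exists_tendsto_div h.mono he_anti he hX hXC ⟨le_rfl, hab⟩ ht).imp fun u hu _ => hu
    · exact ⟨1, fun h => absurd h ht⟩
  choose Y hY using conv
  have lim : ∀ s ∈ Icc a b, ∀ t ∈ Icc a b,
      Tendsto (fun k => ((X k t / X k s : Rˣ) : R)) atTop (𝓝 ((Y t / Y s : Rˣ) : R)) :=
    fun s hs t ht => by
      simpa only [Function.comp_def, div_div_div_cancel_right] using
        (Units.continuous_val.tendsto _).comp ((hY t ht).div' (hY s hs))
  exact ⟨Y, C, isFundamentalSolOn_of_tendsto h.mono he hX hXC lim, fun s hs t ht =>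
    le_of_tendsto' (lim s hs t ht).norm fun k => hXC k s hs t ht⟩

end Limit

section Uniqueness

variable {E : Type*} [NormedAddCommGroup E] [Module R E]

/-- `y` solves `dy = d[A] y` on `S` to first order with respect to the control function `V`. -/
def IsFirstOrderSolOn (A : ℝ → R) (V : ℝ → ℝ) (S : Set ℝ) (y : ℝ → E) : Prop :=
  ∀ τ ∈ S, (fun t => y t - (1 + (A t - A τ)) • y τ) =o[𝓝[S] τ] fun t => V t - V τ

theorem IsFirstOrderSolOn.mono {S T : Set ℝ} {y : ℝ → E} (h : IsFirstOrderSolOn A V T y)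
    (hST : S ⊆ T) : IsFirstOrderSolOn A V S y :=
  fun τ hτ => (h τ (hST hτ)).mono (nhdsWithin_mono τ hST)

variable [IsBoundedSMul R E]

theorem isLittleO_smul_const {α : Type*} {l : Filter α} {f : α → R}
    {g : α → ℝ} (h : f =o[l] g) (v : E) : (fun x => f x • v) =o[l] g :=
  (IsBigO.of_bound ‖v‖ (.of_forall fun x => by
    simpa only [mul_comm] using norm_smul_le (f x) v)).trans_isLittleO h

theorem IsFundamentalSolOn.isFirstOrderSolOn_smul {S : Set ℝ} {X : ℝ → Rˣ}
    (hX : IsFundamentalSolOn A V S X) (v : E) :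
    IsFirstOrderSolOn A V S fun t => (X t : R) • v := fun τ hτ =>
  (isLittleO_smul_const (hX τ hτ) ((X τ : R) • v)).congr_left fun t => by
    rw [sub_smul, smul_smul, ← Units.val_mul, div_mul_cancel]

/-- The function `(X t)⁻¹ y(t)` is constant, having zero derivative with respect to `V`. -/
theorem IsFirstOrderSolOn.eq_div_smul (hV : Monotone V) {a b C : ℝ} {X : ℝ → Rˣ} {y : ℝ → E}
    (hX : IsFundamentalSolOn A V (Icc a b) X) (hC : IsTransitionBoundOn C (Icc a b) X)
    (hy : IsFirstOrderSolOn A V (Icc a b) y) {s t : ℝ} (hs : s ∈ Icc a b) (ht : t ∈ Icc a b) :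
    y t = ((X t / X s : Rˣ) : R) • y s := by
  have ha : a ∈ Icc a b := ⟨le_rfl, hs.1.trans hs.2⟩
  set Z : ℝ → E := fun t => ((X a / X t : Rˣ) : R) • y t
  have loc : ∀ τ ∈ Icc a b, (fun t => Z t - Z τ) =o[𝓝[Icc a b] τ] fun t => V t - V τ := by
    intro τ hτ
    have diff : (fun t => y t - ((X t / X τ : Rˣ) : R) • y τ) =o[𝓝[Icc a b] τ]
        fun t => V t - V τ :=
      ((hy τ hτ).sub (isLittleO_smul_const (hX τ hτ) (y τ))).congr_left fun t => by
        rw [sub_smul]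
        abel
    refine IsBigO.trans_isLittleO (IsBigO.of_bound C ?_) diff
    filter_upwards [self_mem_nhdsWithin] with t ht
    have factor : Z t - Z τ
        = ((X a / X t : Rˣ) : R) • (y t - ((X t / X τ : Rˣ) : R) • y τ) := by
      rw [smul_sub, smul_smul, ← Units.val_mul, div_mul_div_cancel]
    rw [factor]
    exact (norm_smul_le _ _).trans (mul_le_mul_of_nonneg_right (hC t ht a ha) (norm_nonneg _))
  have const : Z t = Z s := eq_of_isLittleO hV loc hs ht
  calc y t = ((X t / X a : Rˣ) : R) • Z t := by
        rw [smul_smul, ← Units.val_mul, div_mul_div_cancel, div_self', Units.val_one, one_smul]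
    _ = ((X t / X s : Rˣ) : R) • y s := by
        rw [const, smul_smul, ← Units.val_mul, div_mul_div_cancel]

end Uniqueness

section WholeLine

theorem IsFundamentalSolOn.mono {S T : Set ℝ} {X : ℝ → Rˣ} (h : IsFundamentalSolOn A V T X)
    (hST : S ⊆ T) : IsFundamentalSolOn A V S X :=
  fun τ hτ => (h τ (hST hτ)).mono (nhdsWithin_mono τ hST)

theorem IsFundamentalSolOn.isFirstOrderSolOn {S : Set ℝ} {X : ℝ → Rˣ}
    (hX : IsFundamentalSolOn A V S X) : IsFirstOrderSolOn A V S fun t => (X t : R) := by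
  simpa only [smul_eq_mul, mul_one] using hX.isFirstOrderSolOn_smul (1 : R)

variable [CompleteSpace R]

theorem IsFundamentalSolOn.exists_isTransitionBoundOn (h : IsRegularIntegrator A V) {a b : ℝ}
    {X : ℝ → Rˣ} (hX : IsFundamentalSolOn A V (Icc a b) X) :
    ∃ C, IsTransitionBoundOn C (Icc a b) X := by
  rcases le_or_gt a b with hab | hba
  · obtain ⟨Y, C, hY, hC⟩ := h.exists_isFundamentalSolOn_Icc hab
    refine ⟨C, fun s hs t ht => ?_⟩
    have : ((X t / X s : Rˣ) : R) = ((Y t / Y s : Rˣ) : R) := by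
      rw [div_eq_mul_inv, Units.val_mul,
        hX.isFirstOrderSolOn.eq_div_smul h.mono hY hC hs ht, smul_eq_mul,
        Units.mul_inv_cancel_right]
    exact this ▸ hC s hs t ht
  · exact ⟨0, fun s hs => absurd (hs.1.trans hs.2) hba.not_ge⟩

theorem IsFirstOrderSolOn.eq_smul {E : Type*} [NormedAddCommGroup E] [Module R E]
    [IsBoundedSMul R E] (h : IsRegularIntegrator A V) {a b : ℝ} {X : ℝ → Rˣ} {y : ℝ → E}
    (hy : IsFirstOrderSolOn A V (Icc a b) y) (hX : IsFundamentalSolOn A V (Icc a b) X) {s t : ℝ}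
    (hs : s ∈ Icc a b) (ht : t ∈ Icc a b) : y t = ((X t / X s : Rˣ) : R) • y s :=
  let ⟨_, hC⟩ := hX.exists_isTransitionBoundOn h
  hy.eq_div_smul h.mono hX hC hs ht

theorem IsFundamentalSolOn.div_eq_div (h : IsRegularIntegrator A V) {a b : ℝ} {X Y : ℝ → Rˣ}
    (hX : IsFundamentalSolOn A V (Icc a b) X) (hY : IsFundamentalSolOn A V (Icc a b) Y) {s t : ℝ}
    (hs : s ∈ Icc a b) (ht : t ∈ Icc a b) : X t / X s = Y t / Y s := by
  rw [div_eq_iff_eq_mul]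
  exact Units.ext (hX.isFirstOrderSolOn.eq_smul h hY hs ht)

theorem IsRegularIntegrator.exists_isFundamentalSolOn_univ (h : IsRegularIntegrator A V) :
    ∃ X : ℝ → Rˣ, X 0 = 1 ∧ IsFundamentalSolOn A V univ X := by
  have zero_mem (N : ℕ) : (0 : ℝ) ∈ Icc (-(N : ℝ)) N := by simp
  choose X _ hX _ using fun N : ℕ =>
    h.exists_isFundamentalSolOn_Icc ((zero_mem N).1.trans (zero_mem N).2)
  set Y : ℝ → Rˣ := fun t => X ⌈|t|⌉₊ t / X ⌈|t|⌉₊ 0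
  have Y_eq (N : ℕ) {t : ℝ} (ht : t ∈ Icc (-(N : ℝ)) N) : Y t = X N t / X N 0 := by
    have hN : ((⌈|t|⌉₊ : ℕ) : ℝ) ≤ N := Nat.cast_le.2 (Nat.ceil_le.2 (abs_le.2 ht))
    exact (hX _).div_eq_div h ((hX N).mono (Icc_subset_Icc (neg_le_neg hN) hN)) (zero_mem _)
      (abs_le.1 (Nat.le_ceil _))
  refine ⟨Y, div_self' _, fun τ _ => ?_⟩
  obtain ⟨N, hN⟩ := exists_nat_gt |τ|
  have hτ := abs_lt.1 hN
  have nhds : Icc (-(N : ℝ)) N ∈ 𝓝 τ := Icc_mem_nhds hτ.1 hτ.2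
  have hXN := hX N τ ⟨hτ.1.le, hτ.2.le⟩
  rw [nhdsWithin_eq_nhds.2 nhds] at hXN
  rw [nhdsWithin_univ]
  refine hXN.congr' ?_ .rfl
  filter_upwards [nhds] with t ht
  rw [Y_eq N ht, Y_eq N ⟨hτ.1.le, hτ.2.le⟩, div_div_div_cancel_right]

end WholeLine

end FundamentalSolution

section KurzweilStieltjes

variable {n : ℕ} {A : ℝ → ROp n} {f F z : ℝ → RSpace n} {δ : ℝ → ℝ} {a b c : ℝ} {X Y Z : RSpace n}

/-- `Y` is the Riemann–Stieltjes sum of a `δ`-fine tagged partition of `[a, b]`. -/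
def IsFineSum (A : ℝ → ROp n) (f : ℝ → RSpace n) (δ : ℝ → ℝ) (a b : ℝ) (Y : RSpace n) : Prop :=
  ∃ (m : ℕ) (α τ : ℕ → ℝ), IsFineTaggedPartition δ a b m α τ ∧
    Y = ∑ j ∈ Finset.range m, (A (α (j + 1)) - A (α j)) (f (τ j))

theorem hasKSIntegralIcc_iff : HasKSIntegralIcc A f a b X ↔ ∀ ε > 0, ∃ δ : ℝ → ℝ,
    (∀ t ∈ Icc a b, 0 < δ t) ∧ ∀ Y, IsFineSum A f δ a b Y → ‖Y - X‖ < ε := by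
  refine forall₂_congr fun ε _ => exists_congr fun δ => and_congr_right fun _ => ⟨?_, ?_⟩
  · rintro h Y ⟨m, α, τ, hp, rfl⟩
    exact h m α τ hp
  · exact fun h m α τ hp => h _ ⟨m, α, τ, hp, rfl⟩

section FineSums

theorem IsFineSum.mono {δ' : ℝ → ℝ} (h : IsFineSum A f δ a b Y) (hle : ∀ t, δ t ≤ δ' t) :
    IsFineSum A f δ' a b Y := by
  obtain ⟨m, α, τ, ⟨h0, hm, hj⟩, rfl⟩ := h
  exact ⟨m, α, τ, ⟨h0, hm, fun j hjm => ⟨(hj j hjm).1, (hj j hjm).2.1, (hj j hjm).2.2.trans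
    (Ioo_subset_Ioo (sub_le_sub_left (hle _) _) (add_le_add_right (hle _) _))⟩⟩, rfl⟩

theorem IsFineSum.add (hY : IsFineSum A f δ a b Y) (hZ : IsFineSum A f δ b c Z) :
    IsFineSum A f δ a c (Y + Z) := by
  obtain ⟨m, α, τ, ⟨h0, hm, hj⟩, rfl⟩ := hY
  obtain ⟨m', α', τ', ⟨h0', hm', hj'⟩, rfl⟩ := hZ
  set β : ℕ → ℝ := fun j => if j ≤ m then α j else α' (j - m)
  set σ : ℕ → ℝ := fun j => if j < m then τ j else τ' (j - m)
  have β_left : ∀ j ≤ m, β j = α j := fun j hj => if_pos hj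
  have β_right : ∀ j, β (m + j) = α' j := by
    rintro (_ | j)
    · rw [add_zero, β_left m le_rfl, hm, h0']
    · simp [β]
  have σ_left : ∀ j < m, σ j = τ j := fun j hj => if_pos hj
  have σ_right : ∀ j, σ (m + j) = τ' j := fun j => by simp [σ]
  refine ⟨m + m', β, σ, ⟨by rw [β_left 0 m.zero_le, h0], by rw [β_right, hm'], fun j hjm => ?_⟩, ?_⟩
  · rcases lt_or_ge j m with hlt | hge
    · rw [β_left j hlt.le, β_left (j + 1) hlt, σ_left j hlt]
      exact hj j hlt
    · obtain ⟨k, rfl⟩ := Nat.exists_eq_add_of_le hge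
      rw [add_assoc, β_right, β_right, σ_right]
      exact hj' k (by omega)
  · rw [Finset.sum_range_add]
    congr 1
    · refine Finset.sum_congr rfl fun j hj => ?_
      have hlt := Finset.mem_range.1 hj
      rw [β_left j hlt.le, β_left (j + 1) hlt, σ_left j hlt]
    · simp only [add_assoc, β_right, σ_right]

theorem isFineSum_single {τ : ℝ} (hab : a < b) (hτ : τ ∈ Icc a b)
    (hfine : Icc a b ⊆ Ioo (τ - δ τ) (τ + δ τ)) :
    IsFineSum A f δ a b ((A b - A a) (f τ)) := by
  refine ⟨1, fun j => if j = 0 then a else b, fun _ => τ, ⟨by simp, by simp, fun j hj => ?_⟩,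
    by simp⟩
  obtain rfl : j = 0 := by omega
  simpa using ⟨hab, hτ, hfine⟩

theorem isFineSum_refl (δ : ℝ → ℝ) (a : ℝ) : IsFineSum A f δ a a 0 :=
  ⟨0, fun _ => a, fun _ => a, ⟨rfl, rfl, fun _ hj => absurd hj (Nat.not_lt_zero _)⟩, by simp⟩

theorem exists_isFineSum (A : ℝ → ROp n) (f : ℝ → RSpace n) (hab : a ≤ b)
    (hδ : ∀ t ∈ Icc a b, 0 < δ t) : ∃ Y, IsFineSum A f δ a b Y := by
  refine cousin_induction (P := fun x y => ∃ Y, IsFineSum A f δ x y Y) hab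
    (fun τ _ => ⟨0, isFineSum_refl δ τ⟩) ?_ (fun τ hτ => ?_) fun τ hτ => ?_
  · rintro x y z _ _ _ _ ⟨Y, hY⟩ ⟨Z, hZ⟩
    exact ⟨_, hY.add hZ⟩
  · have pos := hδ τ (Ico_subset_Icc_self hτ)
    filter_upwards [Ioo_mem_nhdsGT (lt_add_of_pos_right τ pos)] with t ht
    exact ⟨_, isFineSum_single ht.1 ⟨le_rfl, ht.1.le⟩
      (Icc_subset_Ioo (sub_lt_self τ pos) ht.2)⟩
  · have pos := hδ τ (Ioc_subset_Icc_self hτ)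
    filter_upwards [Ioo_mem_nhdsLT (sub_lt_self τ pos)] with t ht
    exact ⟨_, isFineSum_single ht.2 ⟨ht.2.le, le_rfl⟩
      (Icc_subset_Ioo ht.1 (lt_add_of_pos_right τ pos))⟩

theorem IsFineSum.norm_sub_le {ε : ℝ} {V : ℝ → ℝ} (h : IsFineSum A f δ a b Y)
    (hF : ∀ x ∈ Icc a b, ∀ y ∈ Icc a b, ∀ τ ∈ Icc x y, Icc x y ⊆ Ioo (τ - δ τ) (τ + δ τ) →
      ‖(A y - A x) (f τ) - (F y - F x)‖ ≤ ε * (V y - V x)) :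
    ‖Y - (F b - F a)‖ ≤ ε * (V b - V a) := by
  obtain ⟨m, α, τ, ⟨h0, hm, hj⟩, rfl⟩ := h
  have mono : ∀ j k, j ≤ k → k ≤ m → α j ≤ α k := by
    intro j k hjk
    induction k, hjk using Nat.le_induction with
    | base => exact fun _ => le_rfl
    | succ k _ ih => exact fun hk => (ih (by omega)).trans (hj k (by omega)).1.le
  have mem : ∀ j ≤ m, α j ∈ Icc a b := fun j hjm =>
    ⟨h0 ▸ mono 0 j j.zero_le hjm, hm ▸ mono j m hjm le_rfl⟩
  rw [← h0, ← hm, ← Finset.sum_range_sub (fun j => F (α j)),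
    ← Finset.sum_range_sub (fun j => V (α j)), ← Finset.sum_sub_distrib, Finset.mul_sum]
  refine norm_sum_le_of_le _ fun j hjm => ?_
  have hlt := Finset.mem_range.1 hjm
  exact hF _ (mem j hlt.le) _ (mem (j + 1) hlt) _ (hj j hlt).2.1 (hj j hlt).2.2

theorem IsFineSum.of_reflect
    (h : IsFineSum (fun t => A (-t)) (fun t => f (-t)) δ (-b) (-a) Y) :
    IsFineSum A f (fun t => δ (-t)) a b (-Y) := by
  obtain ⟨m, α, τ, ⟨h0, hm, hj⟩, rfl⟩ := h
  have step (j : ℕ) (hj : j < m) : m - j = m - 1 - j + 1 ∧ m - (j + 1) = m - 1 - j := by omega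
  refine ⟨m, fun j => -α (m - j), fun j => -τ (m - 1 - j),
    ⟨by simp [hm], by simp [h0], fun j hjm => ?_⟩, ?_⟩
  · obtain ⟨hlt, hτ, hfine⟩ := hj (m - 1 - j) (by omega)
    simp only [(step j hjm).1, (step j hjm).2]
    refine ⟨neg_lt_neg hlt, ⟨neg_le_neg hτ.2, neg_le_neg hτ.1⟩, fun x hx => ?_⟩
    have hx' := hfine (show -x ∈ Icc _ _ from ⟨le_neg_of_le_neg hx.2, neg_le_of_neg_le hx.1⟩)
    rw [neg_neg]
    exact ⟨by linarith [hx'.2], by linarith [hx'.1]⟩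
  · rw [← Finset.sum_range_reflect, ← Finset.sum_neg_distrib]
    refine Finset.sum_congr rfl fun j hjm => ?_
    simp only [(step j (Finset.mem_range.1 hjm)).1, (step j (Finset.mem_range.1 hjm)).2]
    rw [← neg_apply, neg_sub]

theorem IsFineSum.of_translate {ω : ℝ}
    (h : IsFineSum (fun t => A (t + ω)) (fun t => f (t + ω)) δ a b Y) :
    IsFineSum A f (fun t => δ (t - ω)) (a + ω) (b + ω) Y := by
  obtain ⟨m, α, τ, ⟨h0, hm, hj⟩, rfl⟩ := h
  refine ⟨m, fun j => α j + ω, fun j => τ j + ω, ⟨by simp [h0], by simp [hm], fun j hjm => ?_⟩, rfl⟩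
  obtain ⟨hlt, hτ, hfine⟩ := hj j hjm
  refine ⟨add_lt_add_left hlt ω, ⟨add_le_add_left hτ.1 ω, add_le_add_left hτ.2 ω⟩, fun x hx => ?_⟩
  have hx' := hfine (show x - ω ∈ Icc _ _ from ⟨le_sub_iff_add_le.2 hx.1, sub_le_iff_le_add.2 hx.2⟩)
  simp only [add_sub_cancel_right]
  exact ⟨by linarith [hx'.1], by linarith [hx'.2]⟩

end FineSums

section Integral

theorem HasKSIntegralIcc.reflect (h : HasKSIntegralIcc A f a b X) :
    HasKSIntegralIcc (fun t => A (-t)) (fun t => f (-t)) (-b) (-a) (-X) := by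
  rw [hasKSIntegralIcc_iff] at h ⊢
  intro ε hε
  obtain ⟨δ, hδ, H⟩ := h ε hε
  refine ⟨fun t => δ (-t), fun t ht => hδ _ ⟨le_neg_of_le_neg ht.2, neg_le_of_neg_le ht.1⟩,
    fun Y hY => ?_⟩
  have := H (-Y) (by simpa only [neg_neg] using hY.of_reflect)
  rwa [← norm_neg, neg_sub', neg_neg] at this

theorem HasKSIntegralIcc.translate {ω : ℝ} (h : HasKSIntegralIcc A f (a + ω) (b + ω) X) :
    HasKSIntegralIcc (fun t => A (t + ω)) (fun t => f (t + ω)) a b X := by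
  rw [hasKSIntegralIcc_iff] at h ⊢
  intro ε hε
  obtain ⟨δ, hδ, H⟩ := h ε hε
  refine ⟨fun t => δ (t + ω), fun t ht => hδ _ ⟨add_le_add_left ht.1 ω, add_le_add_left ht.2 ω⟩,
    fun Y hY => H Y ?_⟩
  simpa only [sub_add_cancel] using hY.of_translate

theorem HasKSIntegralIcc.eq_zero (h : HasKSIntegralIcc A f a a X) : X = 0 := by
  refine norm_le_zero_iff.1 (le_of_forall_pos_lt_add fun ε hε => ?_)
  obtain ⟨δ, -, H⟩ := hasKSIntegralIcc_iff.1 h ε hε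
  simpa using H 0 (isFineSum_refl δ a)

theorem HasKSIntegralIcc.norm_sub_le {M : ℝ} (h : HasKSIntegralIcc A f a b X) (hab : a ≤ b)
    (hM : ∀ δ Y, IsFineSum A f δ a b Y → ‖Y - Z‖ ≤ M) : ‖X - Z‖ ≤ M := by
  refine le_of_forall_pos_lt_add fun ε hε => ?_
  obtain ⟨δ, hδ, H⟩ := hasKSIntegralIcc_iff.1 h ε hε
  obtain ⟨Y, hY⟩ := exists_isFineSum A f hab hδ
  calc ‖X - Z‖ ≤ ‖X - Y‖ + ‖Y - Z‖ := norm_sub_le_norm_sub_add_norm_sub _ _ _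
    _ < M + ε := by rw [norm_sub_rev X, add_comm]; exact add_lt_add_of_le_of_lt (hM δ Y hY) (H Y hY)

theorem HasKSIntegralIcc.sub_left (hac : a ≤ c) (hcb : c ≤ b) (hY : HasKSIntegralIcc A f a c Y)
    (hX : HasKSIntegralIcc A f a b X) : HasKSIntegralIcc A f c b (X - Y) := by
  rw [hasKSIntegralIcc_iff] at *
  intro ε hε
  obtain ⟨δ, hδ, H⟩ := hX (ε / 2) (half_pos hε)
  obtain ⟨δ', hδ', H'⟩ := hY (ε / 2) (half_pos hε)
  refine ⟨δ, fun t ht => hδ t ⟨hac.trans ht.1, ht.2⟩, fun Z hZ => ?_⟩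
  obtain ⟨W, hW⟩ := exists_isFineSum A f (δ := fun t => min (δ t) (δ' t)) hac
    fun t ht => lt_min (hδ t ⟨ht.1, ht.2.trans hcb⟩) (hδ' t ht)
  have near_Y := H' W (hW.mono fun t => min_le_right _ _)
  have near_X := H _ ((hW.mono fun t => min_le_left _ _).add hZ)
  calc ‖Z - (X - Y)‖ = ‖(W + Z - X) - (W - Y)‖ := by congr 1; abel
    _ ≤ ‖W + Z - X‖ + ‖W - Y‖ := _root_.norm_sub_le _ _
    _ < ε := by linarith

theorem HasKSIntegralIcc.sub_right (hac : a ≤ c) (hcb : c ≤ b) (hY : HasKSIntegralIcc A f c b Y)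
    (hX : HasKSIntegralIcc A f a b X) : HasKSIntegralIcc A f a c (X - Y) := by
  have := (hY.reflect.sub_left (neg_le_neg hcb) (neg_le_neg hac) hX.reflect).reflect
  simpa only [neg_neg, neg_sub_neg, neg_sub] using this

theorem hasKSIntegralIcc_of_isLittleO {V : ℝ → ℝ} (hV : Monotone V) (hab : a ≤ b)
    (h : ∀ τ ∈ Icc a b,
      (fun t => F t - F τ - (A t - A τ) (f τ)) =o[𝓝[Icc a b] τ] fun t => V t - V τ) :
    HasKSIntegralIcc A f a b (F b - F a) := by
  refine hasKSIntegralIcc_iff.2 fun ε hε => ?_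
  have hVab : 0 ≤ V b - V a := sub_nonneg.2 (hV hab)
  set η := ε / (V b - V a + 1) with hη
  have hη0 : 0 < η := by positivity
  have gauge : ∀ τ, ∃ δ > 0, τ ∈ Icc a b → ∀ t ∈ Icc a b, |t - τ| < δ →
      ‖F t - F τ - (A t - A τ) (f τ)‖ ≤ η * |V t - V τ| := by
    intro τ
    by_cases hτ : τ ∈ Icc a b
    · obtain ⟨δ, hδ, H⟩ := Metric.eventually_nhds_iff.1
        (eventually_nhdsWithin_iff.1 ((h τ hτ).forall_isBigOWith hη0).bound)
      exact ⟨δ, hδ, fun _ t ht htτ => H htτ ht⟩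
    · exact ⟨1, one_pos, fun hτ' => absurd hτ' hτ⟩
  choose δ hδ H using gauge
  refine ⟨δ, fun t _ => hδ t, fun Y hY => ?_⟩
  refine (hY.norm_sub_le (ε := η) (V := V) fun x hx y hy τ hτ hfine => ?_).trans_lt ?_
  · have hτI : τ ∈ Icc a b := ⟨hx.1.trans hτ.1, hτ.2.trans hy.2⟩
    have dist_lt : ∀ t ∈ Icc x y, |t - τ| < δ τ := fun t ht =>
      abs_lt.2 ⟨by linarith [(hfine ht).1], by linarith [(hfine ht).2]⟩
    have hxy : x ≤ y := hτ.1.trans hτ.2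
    have Hx := H τ hτI x hx (dist_lt x (left_mem_Icc.2 hxy))
    have Hy := H τ hτI y hy (dist_lt y (right_mem_Icc.2 hxy))
    rw [abs_sub_comm, abs_of_nonneg (sub_nonneg.2 (hV hτ.1))] at Hx
    rw [abs_of_nonneg (sub_nonneg.2 (hV hτ.2))] at Hy
    calc ‖(A y - A x) (f τ) - (F y - F x)‖
        = ‖(F x - F τ - (A x - A τ) (f τ)) - (F y - F τ - (A y - A τ) (f τ))‖ := by
          congr 1; simp only [sub_apply]; abel
      _ ≤ η * (V y - V x) := (_root_.norm_sub_le _ _).trans (by linarith)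
  · rw [hη, div_mul_eq_mul_div, div_lt_iff₀ (by positivity)]
    nlinarith

end Integral

end KurzweilStieltjes

theorem eventually_nhdsWithin_Icc {p : ℝ → Prop} {a b τ : ℝ} (hτ : p τ)
    (right : τ < b → ∀ᶠ t in 𝓝[>] τ, p t) (left : a < τ → ∀ᶠ t in 𝓝[<] τ, p t) :
    ∀ᶠ t in 𝓝[Icc a b] τ, p t := by
  have above : ∀ᶠ t in 𝓝[>] τ, t ≤ b → p t := by
    rcases lt_or_ge τ b with hτb | hbτ
    · exact (right hτb).mono fun t ht _ => ht
    · filter_upwards [self_mem_nhdsWithin] with t ht htb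
      exact absurd (htb.trans hbτ) (not_le_of_gt ht)
  have below : ∀ᶠ t in 𝓝[<] τ, a ≤ t → p t := by
    rcases lt_or_ge a τ with haτ | hτa
    · exact (left haτ).mono fun t ht _ => ht
    · filter_upwards [self_mem_nhdsWithin] with t ht hat
      exact absurd (hτa.trans hat) (not_le_of_gt ht)
  rw [eventually_nhdsWithin_iff] at above below ⊢
  filter_upwards [above, below] with t ht ht' hI
  rcases lt_trichotomy t τ with h | rfl | h
  exacts [ht' h hI.1, hτ, ht h hI.2]

section Primitive

variable {n : ℕ} {A : ℝ → ROp n} {V : ℝ → ℝ} {f F z : ℝ → RSpace n} {a b τ : ℝ}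

/-- `F` is an indefinite Kurzweil–Stieltjes integral `∫ d[A] f` on `[a, b]`. A solution of the
integral equation is its own primitive. -/
def IsKSPrimitiveOn (A : ℝ → ROp n) (f F : ℝ → RSpace n) (a b : ℝ) : Prop :=
  ∀ c d, a ≤ c → c ≤ d → d ≤ b → HasKSIntegralIcc A f c d (F d - F c)

theorem IsKSPrimitiveOn.mono {a' b' : ℝ} (h : IsKSPrimitiveOn A f F a b) (ha : a ≤ a')
    (hb : b' ≤ b) : IsKSPrimitiveOn A f F a' b' :=
  fun c d hc hcd hd => h c d (ha.trans hc) hcd (hd.trans hb)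

theorem IsKSPrimitiveOn.reflect (h : IsKSPrimitiveOn A f F a b) :
    IsKSPrimitiveOn (fun t => A (-t)) (fun t => f (-t)) (fun t => F (-t)) (-b) (-a) :=
  fun c d hc hcd hd => by
    simpa only [neg_neg, neg_sub] using
      (h (-d) (-c) (le_neg_of_le_neg hd) (neg_le_neg hcd) (neg_le_of_neg_le hc)).reflect

theorem IsKSPrimitiveOn.tendsto_right (h : IsKSPrimitiveOn A f F τ b) (hτb : τ < b) :
    Tendsto (fun t => F t - (A t - A τ) (f τ)) (𝓝[>] τ) (𝓝 (F τ)) := by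
  refine Metric.tendsto_nhds.2 fun ε hε => ?_
  obtain ⟨δ, hδ, H⟩ := hasKSIntegralIcc_iff.1 (h τ b le_rfl hτb.le le_rfl) (ε / 2) (half_pos hε)
  have pos := hδ τ ⟨le_rfl, hτb.le⟩
  filter_upwards [Ioo_mem_nhdsGT hτb, Ioo_mem_nhdsGT (lt_add_of_pos_right τ pos)] with t ht htδ
  obtain ⟨δ', hδ', H'⟩ := hasKSIntegralIcc_iff.1 (h t b ht.1.le ht.2.le le_rfl) (ε / 2)
    (half_pos hε)
  obtain ⟨Z, hZ⟩ := exists_isFineSum A f (δ := fun t => min (δ t) (δ' t)) ht.2.le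
    fun s hs => lt_min (hδ s ⟨ht.1.le.trans hs.1, hs.2⟩) (hδ' s hs)
  have near_tail := H' Z (hZ.mono fun t => min_le_right _ _)
  have first : IsFineSum A f δ τ t ((A t - A τ) (f τ)) :=
    isFineSum_single ht.1 ⟨le_rfl, ht.1.le⟩ (Icc_subset_Ioo (sub_lt_self τ pos) htδ.2)
  have near_whole := H _ (first.add (hZ.mono fun t => min_le_left _ _))
  calc dist (F t - (A t - A τ) (f τ)) (F τ)
      = ‖(Z - (F b - F t)) - ((A t - A τ) (f τ) + Z - (F b - F τ))‖ := by
        rw [dist_eq_norm]; congr 1; abel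
    _ ≤ ‖Z - (F b - F t)‖ + ‖(A t - A τ) (f τ) + Z - (F b - F τ)‖ := norm_sub_le _ _
    _ < ε := by linarith

theorem IsKSPrimitiveOn.norm_sub_sub_le (hA : IsRegularIntegrator A V) {M : ℝ}
    (h : IsKSPrimitiveOn A f F a b) (hab : a ≤ b) (p : RSpace n)
    (hM : ∀ t ∈ Icc a b, ‖f t - p‖ ≤ M) :
    ‖F b - F a - (A b - A a) p‖ ≤ M * (V b - V a) := by
  refine (h a b le_rfl hab le_rfl).norm_sub_le hab fun δ Y hY => ?_
  rw [sub_apply]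
  refine hY.norm_sub_le (F := fun t => A t p) fun x hx y hy σ hσ _ => ?_
  have hxy : ‖A y - A x‖ ≤ V y - V x :=
    abs_of_nonneg (sub_nonneg.2 (hA.mono (hσ.1.trans hσ.2))) ▸ hA.norm_sub_le x y
  have factor : (A y - A x) (f σ) - (A y p - A x p) = (A y - A x) (f σ - p) := by
    simp only [map_sub, sub_apply]
  rw [factor, mul_comm]
  exact (A y - A x).le_of_opNorm_le_of_le hxy (hM σ ⟨hx.1.trans hσ.1, hσ.2.trans hy.2⟩)

theorem IsKSPrimitiveOn.norm_sub_le (hA : IsRegularIntegrator A V) {M : ℝ}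
    (h : IsKSPrimitiveOn A f F a b) (hab : a ≤ b) (hM : ∀ t ∈ Icc a b, ‖f t‖ ≤ M) :
    ‖F b - F a‖ ≤ M * (V b - V a) := by
  simpa using h.norm_sub_sub_le hA hab 0 (by simpa using hM)

theorem IsKSPrimitiveOn.eventually_norm_le (hA : IsRegularIntegrator A V)
    (h : IsKSPrimitiveOn A z z τ b) (hτb : τ < b) :
    ∃ M, ∀ᶠ t in 𝓝[>] τ, ∀ s ∈ Icc τ t, ‖z s‖ ≤ M := by
  obtain ⟨L, hL, -⟩ := hA.right τ
  have lim : Tendsto z (𝓝[>] τ) (𝓝 (z τ + (L - A τ) (z τ))) := by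
    simpa only [Function.comp_def, ContinuousLinearMap.apply_apply, sub_add_cancel] using
      (h.tendsto_right hτb).add
        (((ContinuousLinearMap.apply ℝ _ (z τ)).continuous.tendsto _).comp (hL.sub_const (A τ)))
  obtain ⟨M, hM⟩ := lim.norm.isBoundedUnder_le
  refine ⟨max M ‖z τ‖, (eventually_forall_Ioc hM).mono fun t ht s hs => ?_⟩
  rcases hs.1.eq_or_lt with rfl | hτs
  · exact le_max_right _ _
  · exact le_max_of_le_left (ht s ⟨hτs, hs.2⟩)

theorem IsKSPrimitiveOn.isLittleO_right (hA : IsRegularIntegrator A V)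
    (h : IsKSPrimitiveOn A z z τ b) (hτb : τ < b) :
    (fun t => z t - (1 + (A t - A τ)) • z τ) =o[𝓝[>] τ] fun t => V t - V τ := by
  obtain ⟨M, hM⟩ := h.eventually_norm_le hA hτb
  set v := Function.rightLim V τ
  have hv : Tendsto V (𝓝[>] τ) (𝓝 v) := hA.mono.tendsto_rightLim τ
  refine isLittleO_iff.2 fun ε hε => ?_
  have small : ∀ᶠ t in 𝓝[>] τ, M * (V t - v) < ε :=
    ((hv.sub_const v).const_mul M).eventually_lt_const (by simpa using hε)
  filter_upwards [hM, small, Ioo_mem_nhdsGT hτb] with t htM htε ht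
  have hM0 : 0 ≤ M := (norm_nonneg _).trans (htM τ ⟨le_rfl, ht.1.le⟩)
  have hVt : 0 ≤ V t - V τ := sub_nonneg.2 (hA.mono ht.1.le)
  have lipschitz : ∀ s ∈ Icc τ t, ‖z s - z τ‖ ≤ M * (V t - V τ) := fun s hs =>
    ((h.mono le_rfl (hs.2.trans ht.2.le)).norm_sub_le hA hs.1
      fun r hr => htM r ⟨hr.1, hr.2.trans hs.2⟩).trans
      (mul_le_mul_of_nonneg_left (sub_le_sub_right (hA.mono hs.2) _) hM0)
  have away : ∀ γ ∈ Ioo τ t, ‖z t - z γ - (A t - A γ) (z τ)‖ ≤ ε * (V t - V τ) := fun γ hγ => by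
    have hvγ : v ≤ V γ := hA.mono.rightLim_le hγ.1
    calc _ ≤ M * (V t - V τ) * (V t - V γ) :=
          (h.mono hγ.1.le ht.2.le).norm_sub_sub_le hA hγ.2.le (z τ)
            fun s hs => lipschitz s ⟨hγ.1.le.trans hs.1, hs.2⟩
      _ ≤ M * (V t - V τ) * (V t - v) := by gcongr
      _ = M * (V t - v) * (V t - V τ) := by ring
      _ ≤ ε * (V t - V τ) := by gcongr
  have lim : Tendsto (fun γ => z t - z γ - (A t - A γ) (z τ)) (𝓝[>] τ)
      (𝓝 (z t - (1 + (A t - A τ)) • z τ)) := by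
    convert (h.tendsto_right hτb).const_sub (z t - (A t - A τ) (z τ)) using 2 with γ
    · simp only [sub_apply]
      abel
    · rw [sub_sub, add_comm, add_smul, one_smul]
      rfl
  rw [Real.norm_of_nonneg hVt]
  exact le_of_tendsto lim.norm (by filter_upwards [Ioo_mem_nhdsGT ht.1] with γ hγ using away γ hγ)

theorem IsKSPrimitiveOn.isFirstOrderSolOn (hA : IsRegularIntegrator A V)
    (h : IsKSPrimitiveOn A z z a b) : IsFirstOrderSolOn A V (Icc a b) z := by
  intro τ hτ
  refine isLittleO_iff.2 fun ε hε => eventually_nhdsWithin_Icc ?_ (fun hτb => ?_) fun haτ => ?_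
  · simp
  · exact ((h.mono hτ.1 le_rfl).isLittleO_right hA hτb).def hε
  · have right := (h.mono le_rfl hτ.2).reflect.isLittleO_right hA.reflect (neg_lt_neg haτ)
    have := (right.comp_tendsto tendsto_neg_nhdsLT).neg_right.def hε
    simpa only [Function.comp_def, neg_neg, neg_sub_neg, neg_sub] using this

end Primitive

section TransitionMatrix

theorem isBoundedSMul_clm {𝕜 E : Type*} [NontriviallyNormedField 𝕜] [SeminormedAddCommGroup E]
    [NormedSpace 𝕜 E] : IsBoundedSMul (E →L[𝕜] E) E :=
  .of_norm_smul_le fun f v => f.le_opNorm v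

attribute [local instance] isBoundedSMul_clm

variable {n : ℕ} {A : ℝ → ROp n} {V : ℝ → ℝ} {X : ℝ → (ROp n)ˣ} {U : ℝ → ℝ → ROp n}

theorem IsFirstOrderSolOn.hasKSIntegralIcc (hV : Monotone V) {y : ℝ → RSpace n} {a b : ℝ}
    (hab : a ≤ b) (h : IsFirstOrderSolOn A V (Icc a b) y) :
    HasKSIntegralIcc A y a b (y b - y a) :=
  hasKSIntegralIcc_of_isLittleO hV hab fun τ hτ => (h τ hτ).congr_left fun t => by
    rw [sub_sub, add_smul, one_smul]
    rfl

theorem IsFundamentalSolOn.isTransitionMatrix (hV : Monotone V)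
    (hX : IsFundamentalSolOn A V univ X) :
    IsTransitionMatrix A fun t s => ((X t / X s : (ROp n)ˣ) : ROp n) := by
  intro t s v
  set y : ℝ → RSpace n := fun r => ((X r / X s : (ROp n)ˣ) : ROp n) v with hy
  have y_eq : y = fun r => (X r : ROp n) • (((X s)⁻¹ : (ROp n)ˣ) : ROp n) • v := by
    simp only [hy, div_eq_mul_inv, Units.val_mul, smul_smul]
    rfl
  have sol : IsFirstOrderSolOn A V univ y := y_eq ▸ hX.isFirstOrderSolOn_smul _
  have y_self : y s = v := by simp [hy]
  have integral {a b : ℝ} (hab : a ≤ b) : HasKSIntegralIcc A y a b (y b - y a) :=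
    (sol.mono (subset_univ _)).hasKSIntegralIcc hV hab
  change HasKSIntegral A y s t (y t - v)
  rw [HasKSIntegral, ← y_self]
  split_ifs with hst
  · exact integral hst
  · rw [neg_sub]
    exact integral (le_of_not_ge hst)

theorem IsTransitionMatrix.self (hU : IsTransitionMatrix A U) (s : ℝ) : U s s = 1 := by
  ext1 v
  have := hU s s v
  rw [HasKSIntegral, if_pos le_rfl] at this
  exact sub_eq_zero.1 this.eq_zero

theorem IsTransitionMatrix.isKSPrimitiveOn_right (hU : IsTransitionMatrix A U) (s b : ℝ)
    (v : RSpace n) : IsKSPrimitiveOn A (fun r => U r s v) (fun r => U r s v) s b := by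
  have integral (t : ℝ) (hst : s ≤ t) :
      HasKSIntegralIcc A (fun r => U r s v) s t (U t s v - v) := by
    simpa only [HasKSIntegral, if_pos hst] using hU t s v
  intro c d hsc hcd _
  simpa only [sub_sub_sub_cancel_right] using
    (integral c hsc).sub_left hsc hcd (integral d (hsc.trans hcd))

theorem IsTransitionMatrix.isKSPrimitiveOn_left (hU : IsTransitionMatrix A U) (a s : ℝ)
    (v : RSpace n) : IsKSPrimitiveOn A (fun r => U r s v) (fun r => U r s v) a s := by
  have integral (t : ℝ) (hts : t ≤ s) :
      HasKSIntegralIcc A (fun r => U r s v) t s (v - U t s v) := by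
    rcases hts.eq_or_lt with rfl | hts
    · simpa only [HasKSIntegral, le_rfl, if_true, hU.self, one_apply_eq_self, sub_self] using
        hU t t v
    · simpa only [HasKSIntegral, if_neg hts.not_ge, neg_sub] using hU t s v
  intro c d _ hcd hds
  simpa only [sub_sub_sub_cancel_left] using
    (integral d hds).sub_right hcd hds (integral c (hcd.trans hds))

theorem IsTransitionMatrix.eq_div (hA : IsRegularIntegrator A V)
    (hX : IsFundamentalSolOn A V univ X) (hU : IsTransitionMatrix A U) (t s : ℝ) :
    U t s = ((X t / X s : (ROp n)ˣ) : ROp n) := by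
  ext1 v
  have hs : U s s v = v := by rw [hU.self]; rfl
  rcases le_total s t with hst | hts
  · have sol := (hU.isKSPrimitiveOn_right s t v).isFirstOrderSolOn hA
    have := sol.eq_smul hA (hX.mono (subset_univ _)) (left_mem_Icc.2 hst) (right_mem_Icc.2 hst)
    rwa [hs] at this
  · have sol := (hU.isKSPrimitiveOn_left t s v).isFirstOrderSolOn hA
    have := sol.eq_smul hA (hX.mono (subset_univ _)) (right_mem_Icc.2 hts) (left_mem_Icc.2 hts)
    rwa [hs] at this

theorem IsRegularIntegrator.existsUnique_isTransitionMatrix (hA : IsRegularIntegrator A V) :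
    ∃! U, IsTransitionMatrix A U := by
  obtain ⟨X, -, hX⟩ := hA.exists_isFundamentalSolOn_univ
  refine ⟨_, hX.isTransitionMatrix hA.mono, fun U hU => ?_⟩
  ext1 t
  ext1 s
  exact hU.eq_div hA hX t s

end TransitionMatrix

section Floquet

variable {n : ℕ} {A : ℝ → ROp n} {V : ℝ → ℝ} {X : ℝ → (ROp n)ˣ} {U : ℝ → ℝ → ROp n} {ω : ℝ}

theorem HasKSIntegralIcc.congr_increment {B : ℝ → ROp n} {f : ℝ → RSpace n} {a b : ℝ}
    {Y : RSpace n} (h : HasKSIntegralIcc A f a b Y) (hB : ∀ s t, B t - B s = A t - A s) :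
    HasKSIntegralIcc B f a b Y := by
  simpa only [HasKSIntegralIcc, hB] using h

theorem IsTransitionMatrix.translate (hU : IsTransitionMatrix A U)
    (hA : ∀ s t, A (t + ω) - A (s + ω) = A t - A s) :
    IsTransitionMatrix A fun t s => U (t + ω) (s + ω) := by
  intro t s v
  have := hU (t + ω) (s + ω) v
  simp only [HasKSIntegral, add_le_add_iff_right] at this ⊢
  split_ifs at this ⊢
  all_goals exact this.translate.congr_increment fun s t => (hA s t).symm

theorem add_int_mul_period_eq {G : Type*} [Group G] {X : ℝ → G} {g : G}
    (hX : ∀ t, X (t + ω) = X t * g) (k : ℤ) (t : ℝ) : X (t + k * ω) = X t * g ^ k := by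
  induction k using Int.induction_on generalizing t with
  | zero => simp
  | succ k ih =>
    rw [zpow_add_one, ← mul_assoc, ← ih, ← hX]; congr 1; push_cast; ring
  | pred k ih =>
    rw [zpow_sub_one, ← mul_assoc, ← ih, eq_mul_inv_iff_mul_eq, ← hX]; congr 1; push_cast; ring

theorem tendsto_rightLim_of_locallyBoundedVariationOn {E : Type*} [PseudoEMetricSpace E]
    [CompleteSpace E] {f : ℝ → E} (hf : LocallyBoundedVariationOn f univ) (τ : ℝ) :
    Tendsto f (𝓝[>] τ) (𝓝 (f.rightLim τ)) := by
  obtain ⟨l, hl⟩ := (hf τ (τ + 1) (mem_univ _) (mem_univ _)).exists_tendsto_right τ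
  refine tendsto_rightLim_of_tendsto ⟨l, hl.mono_left ?_⟩
  rw [← nhdsWithin_Ioc_eq_nhdsGT (lt_add_one τ)]
  exact nhdsWithin_mono τ fun t ht => ⟨⟨mem_univ t, ht.1.le, ht.2⟩, ht.1⟩

theorem tendsto_leftLim_of_locallyBoundedVariationOn {E : Type*} [PseudoEMetricSpace E]
    [CompleteSpace E] {f : ℝ → E} (hf : LocallyBoundedVariationOn f univ) (τ : ℝ) :
    Tendsto f (𝓝[<] τ) (𝓝 (f.leftLim τ)) := by
  obtain ⟨l, hl⟩ := (hf (τ - 1) τ (mem_univ _) (mem_univ _)).exists_tendsto_left τ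
  refine tendsto_leftLim_of_tendsto ⟨l, hl.mono_left ?_⟩
  rw [← nhdsWithin_Ico_eq_nhdsLT (sub_one_lt τ)]
  exact nhdsWithin_mono τ fun t ht => ⟨⟨mem_univ t, ht.1, ht.2.le⟩, ht.2⟩

theorem norm_sub_le_variationOnFromTo_sub {E : Type*} [SeminormedAddCommGroup E] {f : ℝ → E}
    (hf : LocallyBoundedVariationOn f univ) (a s t : ℝ) :
    ‖f t - f s‖ ≤ |variationOnFromTo f univ a t - variationOnFromTo f univ a s| := by
  wlog hst : s ≤ t generalizing s t
  · rw [norm_sub_rev, abs_sub_comm]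
    exact this t s (le_of_not_ge hst)
  rw [variationOnFromTo.sub_right hf (mem_univ _) (mem_univ _) (mem_univ _)]
  refine le_trans ?_ (le_abs_self _)
  rw [variationOnFromTo.eq_of_le f univ hst, ← dist_eq_norm, dist_edist]
  exact ENNReal.toReal_mono (hf s t (mem_univ _) (mem_univ _))
    (eVariationOn.edist_le f ⟨mem_univ _, hst, le_rfl⟩ ⟨mem_univ _, le_rfl, hst⟩)

theorem isRegularIntegrator_of_locallyBoundedVariationOn (hA : LocallyBoundedVariationOn A univ)
    (hH : ConditionH A) : IsRegularIntegrator A (variationOnFromTo A univ 0) where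
  mono := monotoneOn_univ.1 (variationOnFromTo.monotoneOn hA (mem_univ _))
  norm_sub_le := norm_sub_le_variationOnFromTo_sub hA 0
  right τ := ⟨_, tendsto_rightLim_of_locallyBoundedVariationOn hA τ, (hH τ).2⟩
  left τ := ⟨_, tendsto_leftLim_of_locallyBoundedVariationOn hA τ, by
    simpa only [jumpLeft, sub_eq_add_neg, neg_add_rev, neg_neg] using (hH τ).1⟩

theorem IsFundamentalSolOn.add_period_eq (hA : IsRegularIntegrator A V)
    (hX : IsFundamentalSolOn A V univ X) (h0 : X 0 = 1) {C : ROp n}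
    (hper : ∀ t, A (t + ω) - A t = C) (t : ℝ) : X (t + ω) = X t * X ω := by
  have increment (s t : ℝ) : A (t + ω) - A (s + ω) = A t - A s := by
    rw [sub_eq_sub_iff_sub_eq_sub, hper, hper]
  have := ((hX.isTransitionMatrix hA.mono).translate increment).eq_div hA hX t 0
  rw [zero_add, Units.val_inj, h0, div_one] at this
  exact div_eq_iff_eq_mul.1 this

end Floquet

section Decay

theorem tendsto_zero_of_le_mul_add {c : ℝ} (hc0 : 0 ≤ c) (hc1 : c < 1) {x y : ℕ → ℝ}
    (hx : ∀ k, 0 ≤ x k) (hy : Tendsto y atTop (𝓝 0)) (h : ∀ k, x (k + 1) ≤ c * x k + y k) :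
    Tendsto x atTop (𝓝 0) := by
  refine (tendsto_order.2 ⟨fun r hr => .of_forall fun k => hr.trans_le (hx k), fun ε hε => ?_⟩)
  obtain ⟨N, source_lt⟩ := eventually_atTop.1
    (hy.eventually_lt_const (mul_pos (half_pos hε) (sub_pos.2 hc1)))
  have geometric (j : ℕ) : x (N + j) ≤ ε / 2 + c ^ j * x N := by
    induction j with
    | zero => simpa using (half_pos hε).le
    | succ j ih =>
      calc x (N + j + 1) ≤ c * x (N + j) + y (N + j) := h _
        _ ≤ c * (ε / 2 + c ^ j * x N) + ε / 2 * (1 - c) := by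
          gcongr
          exact (source_lt _ (Nat.le_add_right N j)).le
        _ = ε / 2 + c ^ (j + 1) * x N := by ring
  have transient : Tendsto (fun j : ℕ => c ^ j * x N) atTop (𝓝 0) := by
    simpa using (tendsto_pow_atTop_nhds_zero_of_lt_one hc0 hc1).mul_const (x N)
  obtain ⟨J, transient_lt⟩ := eventually_atTop.1 (transient.eventually_lt_const (half_pos hε))
  filter_upwards [eventually_ge_atTop (N + J)] with k hk
  obtain ⟨j, rfl⟩ := Nat.exists_eq_add_of_le ((Nat.le_add_right N J).trans hk)
  linarith [geometric j, transient_lt j (by omega)]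

theorem maxGenEigenspace_le_of_sub_mem {R M : Type*} [CommRing R] [AddCommGroup M] [Module R M]
    {f : Module.End R M} {μ : R} {p : Submodule R M} (h : ∀ v, f v - μ • v ∈ p → v ∈ p) :
    f.maxGenEigenspace μ ≤ p := by
  intro v hv
  obtain ⟨k, hk⟩ := (Module.End.mem_maxGenEigenspace f μ v).1 hv
  clear hv
  induction k generalizing v with
  | zero =>
    obtain rfl : v = 0 := by simpa using hk
    exact p.zero_mem
  | succ k ih =>
    refine h v (ih ?_)
    rwa [pow_succ, Module.End.mul_apply] at hk

variable {𝕜 E F : Type*} [NormedField 𝕜] [NormedAddCommGroup E] [NormedSpace 𝕜 E]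

/-- The subspace of vectors whose forward orbit under `T` tends to zero: the stable subspace of
`T`. The unstable subspace of an invertible `T` is the stable subspace of its inverse. -/
def stableSubmodule (T : E →L[𝕜] E) : Submodule 𝕜 E where
  carrier := {v | Tendsto (fun k : ℕ => (T ^ k) v) atTop (𝓝 0)}
  add_mem' hv hw := by simpa only [mem_ofPred_eq, map_add, add_zero] using hv.add hw
  zero_mem' := by simp only [mem_ofPred_eq, map_zero, tendsto_const_nhds]
  smul_mem' c v hv := by simpa only [mem_ofPred_eq, map_smul, smul_zero] using hv.const_smul c

theorem mem_stableSubmodule {T : E →L[𝕜] E} {v : E} :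
    v ∈ stableSubmodule T ↔ Tendsto (fun k : ℕ => (T ^ k) v) atTop (𝓝 0) := Iff.rfl

theorem map_mem_stableSubmodule {𝕜' : Type*} [NormedField 𝕜'] [NormedAddCommGroup F]
    [NormedSpace 𝕜' F] {T : E →L[𝕜] E} {S : F →L[𝕜'] F} {f : E → F} (hf : Continuous f)
    (hf0 : f 0 = 0) (hTS : Function.Semiconj f T S) {v : E} (hv : v ∈ stableSubmodule T) :
    f v ∈ stableSubmodule S := by
  refine mem_stableSubmodule.2 <| Tendsto.congr (fun k => ?_) (hf0 ▸ (hf.tendsto 0).comp hv)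
  simpa only [FunLike.coe_pow_eq_iterate, Function.comp_apply] using (hTS.iterate_right k) v

theorem apply_mem_stableSubmodule {T S : E →L[𝕜] E} (h : Commute T S) {v : E}
    (hv : v ∈ stableSubmodule T) : S v ∈ stableSubmodule T :=
  map_mem_stableSubmodule S.continuous (map_zero S) (DFunLike.congr_fun h.eq.symm) hv

theorem mem_stableSubmodule_of_sub_mem {T : E →L[𝕜] E} {μ : 𝕜} (hμ : ‖μ‖ < 1) {v : E}
    (hv : T v - μ • v ∈ stableSubmodule T) : v ∈ stableSubmodule T := by
  refine tendsto_zero_iff_norm_tendsto_zero.2 <| tendsto_zero_of_le_mul_add (norm_nonneg μ) hμ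
    (fun k => norm_nonneg _) (tendsto_zero_iff_norm_tendsto_zero.1 hv) fun k => ?_
  calc ‖(T ^ (k + 1)) v‖ = ‖μ • (T ^ k) v + (T ^ k) (T v - μ • v)‖ := by
        rw [map_sub, map_smul, add_sub_cancel, pow_succ, mul_apply_eq_comp]
    _ ≤ ‖μ‖ * ‖(T ^ k) v‖ + ‖(T ^ k) (T v - μ • v)‖ :=
        (norm_add_le _ _).trans_eq (by rw [norm_smul])

theorem maxGenEigenspace_le_stableSubmodule {T : E →L[𝕜] E} {μ : 𝕜} (hμ : ‖μ‖ < 1) :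
    Module.End.maxGenEigenspace (T : E →ₗ[𝕜] E) μ ≤ stableSubmodule T :=
  maxGenEigenspace_le_of_sub_mem fun _ => mem_stableSubmodule_of_sub_mem hμ

theorem maxGenEigenspace_le_stableSubmodule_inv {T : (E →L[𝕜] E)ˣ} {μ : 𝕜} (hμ : 1 < ‖μ‖) :
    Module.End.maxGenEigenspace ((T : E →L[𝕜] E) : E →ₗ[𝕜] E) μ ≤
      stableSubmodule ((T⁻¹ : (E →L[𝕜] E)ˣ) : E →L[𝕜] E) := by
  have hμ0 : μ ≠ 0 := norm_pos_iff.1 (one_pos.trans hμ)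
  refine maxGenEigenspace_le_of_sub_mem fun v hv => mem_stableSubmodule_of_sub_mem (μ := μ⁻¹)
    (by rw [norm_inv]; exact inv_lt_one_of_one_lt₀ hμ) ?_
  have inverse_apply (w : E) : (T⁻¹ : (E →L[𝕜] E)ˣ).val (T.val w) = w :=
    DFunLike.congr_fun T.inv_mul w
  convert Submodule.smul_mem _ (-μ⁻¹) (apply_mem_stableSubmodule (Commute.refl _) hv) using 1
  rw [ContinuousLinearMap.coe_coe, map_sub, map_smul, inverse_apply, smul_sub, smul_smul,
    neg_mul, inv_mul_cancel₀ hμ0]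
  module

theorem stableSubmodule_sup_inv_eq_top [IsAlgClosed 𝕜] [FiniteDimensional 𝕜 E]
    (T : (E →L[𝕜] E)ˣ)
    (h : ∀ μ, Module.End.HasEigenvalue ((T : E →L[𝕜] E) : E →ₗ[𝕜] E) μ → ‖μ‖ ≠ 1) :
    stableSubmodule (T : E →L[𝕜] E) ⊔ stableSubmodule ((T⁻¹ : (E →L[𝕜] E)ˣ) : E →L[𝕜] E) = ⊤ := by
  rw [eq_top_iff, ← Module.End.iSup_maxGenEigenspace_eq_top ((T : E →L[𝕜] E) : E →ₗ[𝕜] E)]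
  refine iSup_le fun μ => ?_
  by_cases hbot : Module.End.maxGenEigenspace ((T : E →L[𝕜] E) : E →ₗ[𝕜] E) μ = ⊥
  · exact hbot.le.trans bot_le
  · have hμ : Module.End.HasEigenvalue ((T : E →L[𝕜] E) : E →ₗ[𝕜] E) μ :=
      Module.End.HasUnifEigenvalue.lt (k := ⊤) zero_lt_one hbot
    rcases lt_or_gt_of_ne (h μ hμ) with hlt | hgt
    · exact (maxGenEigenspace_le_stableSubmodule hlt).trans le_sup_left
    · exact (maxGenEigenspace_le_stableSubmodule_inv hgt).trans le_sup_right

end Decay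

section FiniteDimensional

variable {𝕜 E F : Type*} [NontriviallyNormedField 𝕜] [CompleteSpace 𝕜] [NormedAddCommGroup E]
  [NormedSpace 𝕜 E] [FiniteDimensional 𝕜 E] [NormedAddCommGroup F] [NormedSpace 𝕜 F]

theorem tendsto_clm_of_tendsto_apply {ι : Type*} {l : Filter ι} {L : ι → E →L[𝕜] F}
    {L₀ : E →L[𝕜] F} (h : ∀ v, Tendsto (fun i => L i v) l (𝓝 (L₀ v))) : Tendsto L l (𝓝 L₀) := by
  let e : (E →L[𝕜] F) ≃L[𝕜] Fin (Module.finrank 𝕜 E) → F :=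
    ((ContinuousLinearEquiv.ofFinrankEq (Module.finrank_fin_fun 𝕜).symm).arrowCongr
      (1 : F ≃L[𝕜] F)).trans (ContinuousLinearEquiv.piRing _)
  rw [e.toHomeomorph.isInducing.tendsto_nhds_iff]
  exact tendsto_pi_nhds.2 fun i => h _

theorem eventually_norm_pow_apply_le {T : E →L[𝕜] E} {p : Submodule 𝕜 E}
    (hp : p ≤ stableSubmodule T) {c : ℝ} (hc : 0 < c) :
    ∀ᶠ k : ℕ in atTop, ∀ v ∈ p, ‖(T ^ k) v‖ ≤ c * ‖v‖ := by
  have restricted : Tendsto (fun k : ℕ => (T ^ k).comp p.subtypeL) atTop (𝓝 0) :=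
    tendsto_clm_of_tendsto_apply fun v => hp v.2
  filter_upwards [(tendsto_zero_iff_norm_tendsto_zero.1 restricted).eventually_lt_const hc]
    with k hk v hv
  exact ((T ^ k).comp p.subtypeL).le_of_opNorm_le hk.le ⟨v, hv⟩

theorem disjoint_stableSubmodule_inv (T : (E →L[𝕜] E)ˣ) :
    Disjoint (stableSubmodule (T : E →L[𝕜] E))
      (stableSubmodule ((T⁻¹ : (E →L[𝕜] E)ˣ) : E →L[𝕜] E)) := by
  set p := stableSubmodule (T : E →L[𝕜] E)
  set q := stableSubmodule ((T⁻¹ : (E →L[𝕜] E)ˣ) : E →L[𝕜] E)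
  have commute_inv : Commute (T : E →L[𝕜] E) ((T⁻¹ : (E →L[𝕜] E)ˣ) : E →L[𝕜] E) :=
    (Commute.refl T).inv_right.units_val
  obtain ⟨k, forward, backward⟩ :=
    ((eventually_norm_pow_apply_le (inf_le_left : p ⊓ q ≤ p) one_half_pos).and
      (eventually_norm_pow_apply_le (inf_le_right : p ⊓ q ≤ q) one_half_pos)).exists
  refine Submodule.disjoint_def.2 fun v hvp hvq => ?_
  set w := (((T⁻¹ : (E →L[𝕜] E)ˣ) : E →L[𝕜] E) ^ k) v with hw
  have hwv : ((T : E →L[𝕜] E) ^ k) w = v := by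
    rw [hw, ← mul_apply_eq_comp, ← commute_inv.mul_pow, Units.mul_inv, one_pow,
      one_apply_eq_self]
  have hwpq : w ∈ p ⊓ q := ⟨apply_mem_stableSubmodule (commute_inv.pow_right k) hvp,
    apply_mem_stableSubmodule ((Commute.refl _).pow_right k) hvq⟩
  have v_le := forward w hwpq
  have w_le := backward v ⟨hvp, hvq⟩
  rw [hwv] at v_le
  exact norm_le_zero_iff.1 (by linarith [norm_nonneg v])

/-- `P` splits the invertible element `T` hyperbolically: it is a projection commuting with `T`,
the positive powers of `T` tend to zero on its range and the negative powers on its kernel.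
Exponential rates are not part of the definition since they are automatic. -/
structure IsHyperbolicProjection {R : Type*} [NormedRing R] (T : Rˣ) (P : R) : Prop where
  isIdempotentElem : IsIdempotentElem P
  commute : Commute (T : R) P
  tendsto_forward : Tendsto (fun k : ℕ => (T : R) ^ k * P) atTop (𝓝 0)
  tendsto_backward : Tendsto (fun k : ℕ => ((T⁻¹ : Rˣ) : R) ^ k * (1 - P)) atTop (𝓝 0)

theorem exists_isHyperbolicProjection_of_isCompl {T : (E →L[𝕜] E)ˣ}
    (h : IsCompl (stableSubmodule (T : E →L[𝕜] E))
      (stableSubmodule ((T⁻¹ : (E →L[𝕜] E)ˣ) : E →L[𝕜] E))) :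
    ∃ P, IsHyperbolicProjection T P := by
  let P : E →L[𝕜] E := LinearMap.toContinuousLinearMap (Submodule.projection _ _ h)
  have idempotent : IsIdempotentElem P :=
    ContinuousLinearMap.isIdempotentElem_toLinearMap_iff.1 (Submodule.isIdempotentElem_projection h)
  refine ⟨P, idempotent,
    ((ContinuousLinearMap.IsIdempotentElem.commute_iff idempotent).2 ⟨?_, ?_⟩).symm, ?_, ?_⟩
  · rw [show P.range = _ from Submodule.range_projection h]
    exact fun v => apply_mem_stableSubmodule (Commute.refl _)
  · rw [show P.ker = _ from Submodule.ker_projection h]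
    exact fun v => apply_mem_stableSubmodule (Commute.refl T).inv_left.units_val
  · refine tendsto_clm_of_tendsto_apply fun v => ?_
    exact mem_stableSubmodule.1 (Submodule.projection_apply_mem h v)
  · refine tendsto_clm_of_tendsto_apply fun v => ?_
    exact mem_stableSubmodule.1 (Submodule.sub_projection_mem h v)

end FiniteDimensional

section Dichotomy

theorem exists_le_mul_exp_of_submultiplicative {b : ℕ → ℝ} (h0 : ∀ k, 0 ≤ b k)
    (hmul : ∀ j k, b (j + k) ≤ b j * b k) (hb : Tendsto b atTop (𝓝 0)) :
    ∃ K > 0, ∃ β > 0, ∀ k : ℕ, b k ≤ K * Real.exp (-β * k) := by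
  obtain ⟨N, hbN, hN⟩ := ((hb.eventually_lt_const (Real.exp_pos (-1))).and
    (eventually_gt_atTop 0)).exists
  have block (q r : ℕ) : b (N * q + r) ≤ Real.exp (-1) ^ q * b r := by
    induction q with
    | zero => simp
    | succ q ih =>
      calc b (N * (q + 1) + r) = b (N + (N * q + r)) := by ring_nf
        _ ≤ b N * b (N * q + r) := hmul _ _
        _ ≤ Real.exp (-1) * (Real.exp (-1) ^ q * b r) := by
          gcongr
          exact h0 _
        _ = Real.exp (-1) ^ (q + 1) * b r := by ring
  set B := 1 + ∑ r ∈ Finset.range N, b r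
  have hB : 0 < B := add_pos_of_pos_of_nonneg one_pos (Finset.sum_nonneg fun r _ => h0 r)
  have remainder (r : ℕ) (hr : r < N) : b r ≤ B :=
    (Finset.single_le_sum (fun r _ => h0 r) (Finset.mem_range.2 hr)).trans
      (le_add_of_nonneg_left zero_le_one)
  refine ⟨B * Real.exp 1, by positivity, 1 / N, by positivity, fun k => ?_⟩
  have quotient : (k : ℝ) / N ≤ (k / N : ℕ) + 1 := by
    rw [div_le_iff₀' (by positivity)]
    exact_mod_cast (Nat.lt_mul_div_succ k hN).le
  calc b k = b (N * (k / N) + k % N) := by rw [Nat.div_add_mod]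
    _ ≤ Real.exp (-1) ^ (k / N) * b (k % N) := block _ _
    _ ≤ Real.exp (-1) ^ (k / N) * B := by gcongr; exact remainder _ (Nat.mod_lt k hN)
    _ = B * Real.exp (-(k / N : ℕ)) := by rw [← Real.exp_nat_mul, mul_neg_one, mul_comm]
    _ ≤ B * Real.exp (1 + -(1 / N) * k) := by
      gcongr
      linarith [show 1 / (N : ℝ) * k = k / N by ring]
    _ = B * Real.exp 1 * Real.exp (-(1 / N) * k) := by rw [Real.exp_add, mul_assoc]

variable {R : Type*} [NormedRing R]

theorem exists_norm_pow_mul_le_exp {T P : R} (hP : IsIdempotentElem P) (hTP : Commute T P)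
    (h : Tendsto (fun k : ℕ => T ^ k * P) atTop (𝓝 0)) :
    ∃ K > 0, ∃ β > 0, ∀ k : ℕ, ‖T ^ k * P‖ ≤ K * Real.exp (-β * k) := by
  refine exists_le_mul_exp_of_submultiplicative (fun k => norm_nonneg _) (fun j k => ?_)
    (tendsto_zero_iff_norm_tendsto_zero.1 h)
  calc ‖T ^ (j + k) * P‖ = ‖(T ^ j * P) * (T ^ k * P)‖ := by
        rw [(hTP.pow_left k).eq, mul_assoc, ← mul_assoc P, hP.eq, ← (hTP.pow_left k).eq,
          ← mul_assoc, pow_add]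
    _ ≤ ‖T ^ j * P‖ * ‖T ^ k * P‖ := norm_mul_le _ _

theorem IsHyperbolicProjection.exists_norm_zpow_mul_le_exp {T : Rˣ} {P : R}
    (h : IsHyperbolicProjection T P) :
    ∃ K > 0, ∃ β > 0, (∀ k : ℤ, 0 ≤ k → ‖((T ^ k : Rˣ) : R) * P‖ ≤ K * Real.exp (-β * |(k : ℝ)|)) ∧
      ∀ k : ℤ, k ≤ 0 → ‖((T ^ k : Rˣ) : R) * (1 - P)‖ ≤ K * Real.exp (-β * |(k : ℝ)|) := by
  obtain ⟨K₁, hK₁, β₁, hβ₁, forward⟩ :=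
    exists_norm_pow_mul_le_exp h.isIdempotentElem h.commute h.tendsto_forward
  obtain ⟨K₂, _, β₂, hβ₂, backward⟩ := exists_norm_pow_mul_le_exp h.isIdempotentElem.one_sub
    ((Commute.one_right _).sub_right h.commute.units_inv_left) h.tendsto_backward
  refine ⟨max K₁ K₂, lt_max_of_lt_left hK₁, min β₁ β₂, lt_min hβ₁ hβ₂, fun k hk => ?_,
    fun k hk => ?_⟩
  · obtain ⟨m, rfl⟩ := Int.eq_ofNat_of_zero_le hk
    rw [zpow_natCast, Units.val_pow_eq_pow_val, Int.cast_natCast, Nat.abs_cast]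
    refine (forward m).trans ?_
    gcongr
    exacts [le_max_left _ _, min_le_left _ _]
  · obtain ⟨m, rfl⟩ := Int.exists_eq_neg_ofNat hk
    rw [zpow_neg, zpow_natCast, ← inv_pow, Units.val_pow_eq_pow_val, Int.cast_neg,
      Int.cast_natCast, abs_neg, Nat.abs_cast]
    refine (backward m).trans ?_
    gcongr
    exacts [le_max_right _ _, min_le_right _ _]

variable {X : ℝ → Rˣ} {g : Rˣ} {P : R} {ω C : ℝ}

theorem mul_mul_inv_eq_of_period (hω : ω ≠ 0) (hX : ∀ t, X (t + ω) = X t * g)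
    (hP : Commute (g : R) P) (t s : ℝ) :
    (X t : R) * P * ((X s)⁻¹ : Rˣ) = (X (Int.fract (t / ω) * ω) : R) *
      (((g ^ (⌊t / ω⌋ - ⌊s / ω⌋) : Rˣ) : R) * P) * ((X (Int.fract (s / ω) * ω))⁻¹ : Rˣ) := by
  have reduce (r : ℝ) : X r = X (Int.fract (r / ω) * ω) * g ^ ⌊r / ω⌋ := by
    rw [← add_int_mul_period_eq hX, ← add_mul, Int.fract_add_floor, div_mul_cancel₀ _ hω]
  rw [reduce t, reduce s, mul_inv_rev, ← zpow_neg, sub_eq_add_neg, zpow_add]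
  simp only [Units.val_mul, mul_assoc]
  rw [(hP.units_zpow_left (-⌊s / ω⌋)).left_comm]

theorem norm_mul_mul_inv_le_of_period (hω : 0 < ω) (hX : ∀ t, X (t + ω) = X t * g) (h0 : X 0 = 1)
    (hC : IsTransitionBoundOn C (Icc 0 ω) X) (hP : Commute (g : R) P) (t s : ℝ) :
    ‖(X t : R) * P * ((X s)⁻¹ : Rˣ)‖ ≤ C * ‖((g ^ (⌊t / ω⌋ - ⌊s / ω⌋) : Rˣ) : R) * P‖ * C := by
  have fract_mem (r : ℝ) : Int.fract (r / ω) * ω ∈ Icc 0 ω :=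
    ⟨by have := Int.fract_nonneg (r / ω); positivity,
      mul_le_of_le_one_left hω.le (Int.fract_lt_one _).le⟩
  have zero_mem : (0 : ℝ) ∈ Icc 0 ω := left_mem_Icc.2 hω.le
  have bound := hC 0 zero_mem _ (fract_mem t)
  have inv_bound := hC _ (fract_mem s) 0 zero_mem
  rw [h0, div_one] at bound
  rw [h0, one_div] at inv_bound
  rw [mul_mul_inv_eq_of_period hω.ne' hX hP]
  have hC0 : 0 ≤ C := (norm_nonneg _).trans bound
  refine (norm_mul_le _ _).trans (mul_le_mul ?_ inv_bound (norm_nonneg _) (by positivity))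
  exact (norm_mul_le _ _).trans (mul_le_mul_of_nonneg_right bound (norm_nonneg _))

theorem exp_neg_mul_abs_floor_sub_le (hω : 0 < ω) {β : ℝ} (hβ : 0 ≤ β) (t s : ℝ) :
    Real.exp (-β * |((⌊t / ω⌋ - ⌊s / ω⌋ : ℤ) : ℝ)|) ≤
      Real.exp β * Real.exp (-(β / ω) * |t - s|) := by
  have abs_sub_le : |t / ω - s / ω| ≤ |((⌊t / ω⌋ - ⌊s / ω⌋ : ℤ) : ℝ)| + 1 := by
    have fract_sub : |Int.fract (t / ω) - Int.fract (s / ω)| ≤ 1 :=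
      abs_sub_le_iff.2
        ⟨by linarith [Int.fract_lt_one (t / ω), Int.fract_nonneg (s / ω)],
          by linarith [Int.fract_lt_one (s / ω), Int.fract_nonneg (t / ω)]⟩
    calc |t / ω - s / ω|
        = |((⌊t / ω⌋ - ⌊s / ω⌋ : ℤ) : ℝ) + (Int.fract (t / ω) - Int.fract (s / ω))| := by
          rw [Int.cast_sub, ← Int.self_sub_floor, ← Int.self_sub_floor]; ring_nf
      _ ≤ _ := (abs_add_le _ _).trans (by gcongr)
  rw [← sub_div, abs_div, abs_of_pos hω] at abs_sub_le
  rw [← Real.exp_add, Real.exp_le_exp]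
  calc -β * |((⌊t / ω⌋ - ⌊s / ω⌋ : ℤ) : ℝ)|
      = β - β * (|((⌊t / ω⌋ - ⌊s / ω⌋ : ℤ) : ℝ)| + 1) := by ring
    _ ≤ β - β * (|t - s| / ω) := by gcongr
    _ = β + -(β / ω) * |t - s| := by ring

theorem norm_mul_mul_inv_le_exp (hω : 0 < ω) (hX : ∀ t, X (t + ω) = X t * g) (h0 : X 0 = 1)
    (hC : IsTransitionBoundOn C (Icc 0 ω) X) (hP : Commute (g : R) P) {K β : ℝ} (hK : 0 ≤ K)
    (hβ : 0 ≤ β) {t s : ℝ} (h : ‖((g ^ (⌊t / ω⌋ - ⌊s / ω⌋) : Rˣ) : R) * P‖ ≤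
      K * Real.exp (-β * |((⌊t / ω⌋ - ⌊s / ω⌋ : ℤ) : ℝ)|)) :
    ‖(X t : R) * P * ((X s)⁻¹ : Rˣ)‖ ≤
      C ^ 2 * K * Real.exp β * Real.exp (-(β / ω) * |t - s|) := by
  have hC0 : 0 ≤ C :=
    (norm_nonneg _).trans (hC 0 (left_mem_Icc.2 hω.le) 0 (left_mem_Icc.2 hω.le))
  calc ‖(X t : R) * P * ((X s)⁻¹ : Rˣ)‖
      ≤ C * ‖((g ^ (⌊t / ω⌋ - ⌊s / ω⌋) : Rˣ) : R) * P‖ * C :=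
        norm_mul_mul_inv_le_of_period hω hX h0 hC hP t s
    _ ≤ C * (K * (Real.exp β * Real.exp (-(β / ω) * |t - s|))) * C := by
        gcongr
        exact h.trans (by gcongr; exact exp_neg_mul_abs_floor_sub_le hω hβ t s)
    _ = _ := by ring

end Dichotomy

section ExponentialDichotomy

variable {n : ℕ} {X : ℝ → (ROp n)ˣ} {g : (ROp n)ˣ} {U : ℝ → ℝ → ROp n} {P : ROp n} {ω C : ℝ}

theorem IsHyperbolicProjection.hasExponentialDichotomy (hP : IsHyperbolicProjection g P)
    (hω : 0 < ω) (hX : ∀ t, X (t + ω) = X t * g) (h0 : X 0 = 1)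
    (hC : IsTransitionBoundOn C (Icc 0 ω) X) (hU : ∀ t, U t 0 = X t) :
    HasExponentialDichotomy U := by
  obtain ⟨K, hK, β, hβ, forward, backward⟩ := hP.exists_norm_zpow_mul_le_exp
  refine ⟨C ^ 2 * K * Real.exp β + 1, β / ω, P, by positivity, by positivity, hP.isIdempotentElem,
    fun t s hst => ?_, fun t s hts => ?_⟩
  · rw [hU, hU, Ring.inverse_unit]
    refine (norm_mul_mul_inv_le_exp hω hX h0 hC hP.commute hK.le hβ.le
      (forward _ (sub_nonneg.2 (Int.floor_mono (by gcongr))))).trans ?_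
    rw [abs_of_nonneg (sub_nonneg.2 hst)]
    gcongr
    exact le_add_of_nonneg_right zero_le_one
  · rw [hU, hU, Ring.inverse_unit]
    refine (norm_mul_mul_inv_le_exp hω hX h0 hC ((Commute.one_right _).sub_right hP.commute) hK.le
      hβ.le (backward _ (sub_nonpos.2 (Int.floor_mono (by gcongr))))).trans ?_
    rw [abs_sub_comm, abs_of_nonneg (sub_nonneg.2 hts)]
    gcongr
    exact le_add_of_nonneg_right zero_le_one

theorem HasExponentialDichotomy.exists_tendsto_mul_pow (h : HasExponentialDichotomy U)
    (hω : 0 < ω) (hX : ∀ t, X (t + ω) = X t * g) (h0 : X 0 = 1) (hU : ∀ t, U t 0 = X t) :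
    ∃ P : ROp n, Tendsto (fun k : ℕ => P * ((g ^ k : (ROp n)ˣ) : ROp n)) atTop (𝓝 0) ∧
      Tendsto (fun k : ℕ => (1 - P) * ((g⁻¹ ^ k : (ROp n)ˣ) : ROp n)) atTop (𝓝 0) := by
  obtain ⟨K, α, P, -, hα, -, forward, backward⟩ := h
  have U_period (k : ℤ) : U (k * ω) 0 = ((g ^ k : (ROp n)ˣ) : ROp n) := by
    rw [hU, ← zero_add (k * ω), add_int_mul_period_eq hX, h0, one_mul]
  have decay : Tendsto (fun k : ℕ => K * Real.exp (-α * (k * ω))) atTop (𝓝 0) := by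
    have : Tendsto (fun k : ℕ => -α * ((k : ℝ) * ω)) atTop atBot :=
      (tendsto_natCast_atTop_atTop.atTop_mul_const hω).const_mul_atTop_of_neg (neg_neg_of_pos hα)
    simpa using (Real.tendsto_exp_atBot.comp this).const_mul K
  refine ⟨P, squeeze_zero_norm (fun k => ?_) decay, squeeze_zero_norm (fun k => ?_) decay⟩
  · have hk : 0 ≤ (k : ℝ) * ω := by positivity
    have := forward 0 ((-k : ℤ) * ω) (by push_cast; linarith)
    rw [U_period, Ring.inverse_unit, hU, h0] at this
    simpa using this
  · have hk : 0 ≤ (k : ℝ) * ω := by positivity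
    have := backward 0 ((k : ℤ) * ω) (by push_cast; linarith)
    rw [U_period, Ring.inverse_unit, hU, h0] at this
    simpa using this

end ExponentialDichotomy

section BoundedOrbit

variable {𝕜 E : Type*} [NontriviallyNormedField 𝕜] [NormedAddCommGroup E] [NormedSpace 𝕜 E]

theorem apply_eq_zero_of_tendsto_mul {P : E →L[𝕜] E} {T : ℕ → (E →L[𝕜] E)ˣ} {v : E} {c : ℝ}
    (hP : Tendsto (fun k => P * (T k : E →L[𝕜] E)) atTop (𝓝 0))
    (hv : ∀ k, ‖(((T k)⁻¹ : (E →L[𝕜] E)ˣ) : E →L[𝕜] E) v‖ ≤ c) : P v = 0 := by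
  refine norm_le_zero_iff.1 (ge_of_tendsto' (x := atTop)
    (f := fun k => ‖P * (T k : E →L[𝕜] E)‖ * c) ?_ fun k => ?_)
  · simpa using hP.norm.mul_const c
  · calc ‖P v‖ = ‖(P * (T k : E →L[𝕜] E)) ((((T k)⁻¹ : (E →L[𝕜] E)ˣ) : E →L[𝕜] E) v)‖ := by
          rw [← mul_apply_eq_comp, mul_assoc, Units.mul_inv, mul_one]
      _ ≤ ‖P * (T k : E →L[𝕜] E)‖ * c := ContinuousLinearMap.le_opNorm_of_le _ (hv k)

theorem eq_zero_of_bounded_orbit {P : E →L[𝕜] E} {T : (E →L[𝕜] E)ˣ} {v : E} {c : ℝ}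
    (forward : Tendsto (fun k : ℕ => P * ((T ^ k : (E →L[𝕜] E)ˣ) : E →L[𝕜] E)) atTop (𝓝 0))
    (backward : Tendsto (fun k : ℕ => (1 - P) * ((T⁻¹ ^ k : (E →L[𝕜] E)ˣ) : E →L[𝕜] E)) atTop
      (𝓝 0))
    (hv : ∀ k : ℤ, ‖((T ^ k : (E →L[𝕜] E)ˣ) : E →L[𝕜] E) v‖ ≤ c) : v = 0 := by
  have hPv : P v = 0 := apply_eq_zero_of_tendsto_mul forward fun k => by
    simpa only [zpow_neg, zpow_natCast] using hv (-k)
  have hQv : (1 - P) v = 0 := apply_eq_zero_of_tendsto_mul backward fun k => by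
    simpa only [inv_pow, inv_inv, zpow_natCast] using hv k
  simpa [hPv] using hQv

end BoundedOrbit

section Complexification

variable {n : ℕ}

/-- Extension of scalars of an operator on `ℝⁿ` to `ℂⁿ`, as the multiplicative map
`M ↦ (x ↦ complexMatrix M *ᵥ x)`. -/
noncomputable def complexification : ROp n →* ((Fin n → ℂ) →L[ℂ] (Fin n → ℂ)) where
  toFun M := LinearMap.toContinuousLinearMap (Matrix.toLin' (complexMatrix M))
  map_one' := by
    ext1 v
    simp [complexMatrix]
  map_mul' M N := by
    ext1 v
    have : complexMatrix (M * N) = complexMatrix M * complexMatrix N := by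
      rw [complexMatrix, ContinuousLinearMap.toLinearMap_mul, LinearMap.toMatrix_mul,
        Matrix.map_mul]
      rfl
    simp [this]

/-- The coordinatewise real part `ℂⁿ → ℝⁿ`. -/
noncomputable def rePart : (Fin n → ℂ) →L[ℝ] RSpace n :=
  (EuclideanSpace.equiv (Fin n) ℝ).symm ∘L
    ContinuousLinearMap.pi fun i => Complex.reCLM ∘L ContinuousLinearMap.proj i

@[simp]
theorem rePart_apply (v : Fin n → ℂ) (i : Fin n) : rePart v i = (v i).re := rfl

theorem rePart_complexification (M : ROp n) (v : Fin n → ℂ) :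
    rePart (complexification M v) = M (rePart v) := by
  ext i
  have := congrFun (LinearMap.toMatrix_mulVec_repr (EuclideanSpace.basisFun (Fin n) ℝ).toBasis
    (EuclideanSpace.basisFun (Fin n) ℝ).toBasis (M : RSpace n →ₗ[ℝ] RSpace n) (rePart v)) i
  simp only [OrthonormalBasis.coe_toBasis_repr_apply, EuclideanSpace.basisFun_repr] at this
  refine Eq.trans ?_ this
  simp [complexification, complexMatrix, Matrix.mulVec, dotProduct]

theorem exists_rePart_smul_ne_zero {v : Fin n → ℂ} (hv : v ≠ 0) :
    ∃ z : ℂ, rePart (z • v) ≠ 0 := by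
  obtain ⟨i, hi⟩ := Function.ne_iff.1 hv
  refine ⟨(v i)⁻¹, fun h => one_ne_zero (α := ℝ) ?_⟩
  simpa [inv_mul_cancel₀ hi] using congrArg (fun w : RSpace n => w i) h

theorem isCompl_stableSubmodule_inv (M : (ROp n)ˣ)
    (hM : ∀ μ, IsComplexEigenvalue (M : ROp n) μ → ‖μ‖ ≠ 1) :
    IsCompl (stableSubmodule (M : ROp n)) (stableSubmodule ((M⁻¹ : (ROp n)ˣ) : ROp n)) := by
  refine ⟨disjoint_stableSubmodule_inv M, codisjoint_iff.2 (eq_top_iff.2 fun w _ => ?_)⟩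
  have complex_split := stableSubmodule_sup_inv_eq_top (Units.map complexification M) hM
  obtain ⟨u, hu, v, hv, huv⟩ := Submodule.mem_sup.1
    (complex_split.ge (Submodule.mem_top (x := fun i => (w i : ℂ))))
  refine Submodule.mem_sup.2 ⟨rePart u, ?_, rePart v, ?_, ?_⟩
  · exact map_mem_stableSubmodule rePart.continuous (map_zero _) (rePart_complexification _) hu
  · exact map_mem_stableSubmodule rePart.continuous (map_zero _) (rePart_complexification _) hv
  · rw [← map_add, huv]
    ext i
    simp

theorem zpow_apply_eq_of_apply_eq {𝕜 E : Type*} [NontriviallyNormedField 𝕜]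
    [NormedAddCommGroup E] [NormedSpace 𝕜 E] {T : (E →L[𝕜] E)ˣ} {v : E} {μ : 𝕜} (hμ : μ ≠ 0)
    (h : (T : E →L[𝕜] E) v = μ • v) (k : ℤ) :
    ((T ^ k : (E →L[𝕜] E)ˣ) : E →L[𝕜] E) v = μ ^ k • v := by
  have h_inv : ((T⁻¹ : (E →L[𝕜] E)ˣ) : E →L[𝕜] E) v = μ⁻¹ • v := by
    rw [eq_inv_smul_iff₀ hμ, ← map_smul, ← h, ← mul_apply_eq_comp, Units.inv_mul,
      one_apply_eq_self]
  induction k with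
  | zero => simp
  | succ k ih => rw [zpow_add_one, Units.val_mul, mul_apply_eq_comp, h, map_smul, ih, smul_smul,
      zpow_add_one₀ hμ, mul_comm]
  | pred k ih => rw [zpow_sub_one, Units.val_mul, mul_apply_eq_comp, h_inv, map_smul, ih,
      smul_smul, zpow_sub_one₀ hμ, mul_comm]

theorem exists_bounded_orbit (M : (ROp n)ˣ) {μ : ℂ} (hM : IsComplexEigenvalue (M : ROp n) μ)
    (hμ : ‖μ‖ = 1) :
    ∃ w ≠ 0, ∃ c, ∀ k : ℤ, ‖((M ^ k : (ROp n)ˣ) : ROp n) w‖ ≤ c := by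
  obtain ⟨v, hv⟩ := hM.exists_hasEigenvector
  obtain ⟨z, hz⟩ := exists_rePart_smul_ne_zero hv.2
  have eigenvector : (Units.map complexification M : (Fin n → ℂ) →L[ℂ] (Fin n → ℂ)) (z • v) =
      μ • z • v := by
    rw [map_smul, smul_comm]
    exact congrArg (z • ·) hv.apply_eq_smul
  refine ⟨rePart (z • v), hz, ‖(rePart : (Fin n → ℂ) →L[ℝ] RSpace n)‖ * ‖z • v‖, fun k => ?_⟩
  rw [← rePart_complexification, ← Units.coe_map, map_zpow,
    zpow_apply_eq_of_apply_eq (norm_ne_zero_iff.1 (hμ ▸ one_ne_zero)) eigenvector]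
  refine (rePart.le_opNorm _).trans_eq ?_
  rw [norm_smul, norm_zpow, hμ, one_zpow, one_mul]

end Complexification

theorem theorem3p3 {n : ℕ} (A : ℝ → ROp n)
    (hA : LocallyBoundedVariationOn A Set.univ) (hH : ConditionH A)
    (ω : ℝ) (hω : 0 < ω) (C : ROp n) (hper : ∀ t : ℝ, A (t + ω) - A t = C) :
    (∃! U : ℝ → ℝ → ROp n, IsTransitionMatrix A U) ∧
    ∀ U : ℝ → ℝ → ROp n, IsTransitionMatrix A U →
      (HasExponentialDichotomy U ↔ ∀ μ : ℂ, IsComplexEigenvalue (U ω 0) μ → ‖μ‖ ≠ 1) := by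
  have integrator := isRegularIntegrator_of_locallyBoundedVariationOn hA hH
  refine ⟨integrator.existsUnique_isTransitionMatrix, fun U hU => ?_⟩
  obtain ⟨X, h0, hX⟩ := integrator.exists_isFundamentalSolOn_univ
  have period : ∀ t, X (t + ω) = X t * X ω := hX.add_period_eq integrator h0 hper
  have eq_X (t : ℝ) : U t 0 = X t := by rw [hU.eq_div integrator hX, h0, div_one]
  rw [eq_X ω]
  constructor
  · intro dichotomy μ hμ norm_eq_one
    obtain ⟨P, forward, backward⟩ := dichotomy.exists_tendsto_mul_pow hω period h0 eq_X
    obtain ⟨w, hw, c, bounded⟩ := exists_bounded_orbit (X ω) hμ norm_eq_one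
    exact hw (eq_zero_of_bounded_orbit forward backward bounded)
  · intro spectrum
    obtain ⟨P, hP⟩ :=
      exists_isHyperbolicProjection_of_isCompl (isCompl_stableSubmodule_inv (X ω) spectrum)
    obtain ⟨c, hc⟩ := (hX.mono (subset_univ _)).exists_isTransitionBoundOn integrator
    exact hP.hasExponentialDichotomy hω period h0 hc eq_X
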